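/- Let $\mathbb D=\{z\in\mathbb C:|z|<1\}$. For real $K\ge 2$ let $\mathcal V_K$ be the class of all analytic, locally univalent functions $h$ in $\mathbb D$ with $h(0)=0$, $h'(0)=1$ and $$\int_0^{2\pi}\left|\operatorname{Re}\left(1+\frac{re^{it}h''(re^{it})}{h'(re^{it})}\right)\right|dt\le K\pi\qquad\text{for all }0<r<1.$$ Let $\delta\in[0,2]$, $2\le K\le 4-\delta$, $\theta\in\mathbb R$, let $h\in\mathcal V_K$, and let $g$ be analytic in $\mathbb D$ with $$g'(z)=e^{i\theta}\sin\left(\frac{\delta\pi}{4}\right)z\,h'(z)\qquad\text{for all }z\in\mathbb D.$$ Then the harmonic mapping $f=h+\overline g$ is univalent (injective) in $\mathbb D$, and it is close-to-convex, that is, $\mathbb C\setminus f(\mathbb D)$ is a union of closed half-lines whose interiors (the half-lines without their endpoints) are pairwise disjoint. -/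

import Mathlib

open scoped ComplexConjugate

/-- `h` is locally univalent (locally injective) on the set `U`. -/
def LocallyUnivalentOn (h : ℂ → ℂ) (U : Set ℂ) : Prop :=
  ∀ z ∈ U, ∃ V ∈ nhds z, Set.InjOn h V

/-- The class `𝒱_K` of normalized analytic, locally univalent functions on the unit disk whose
boundary rotation is bounded by `K π`. -/
structure MemVK (K : ℝ) (h : ℂ → ℂ) : Prop where
  analytic : AnalyticOnNhd ℂ h (Metric.ball 0 1)
  locallyUnivalent : LocallyUnivalentOn h (Metric.ball 0 1)
  map_zero : h 0 = 0
  deriv_zero : deriv h 0 = 1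
  rotation_le : ∀ r : ℝ, 0 < r → r < 1 →
    ∫ t in (0 : ℝ)..(2 * Real.pi),
      |(1 + (r * Complex.exp (t * Complex.I)) * deriv (deriv h) (r * Complex.exp (t * Complex.I)) /
        deriv h (r * Complex.exp (t * Complex.I))).re| ≤ K * Real.pi

/-- The closed half-line with endpoint `a` and direction `d`. -/
def closedHalfLine (a d : ℂ) : Set ℂ := {w | ∃ t : ℝ, 0 ≤ t ∧ w = a + t * d}

/-- The interior of a half-line: the half-line without its endpoint. -/
def openHalfLine (a d : ℂ) : Set ℂ := {w | ∃ t : ℝ, 0 < t ∧ w = a + t * d}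

/-- A plane set is close-to-convex if its complement is a union of closed half-lines
with pairwise disjoint interiors. A half-line is given by its endpoint and unit direction. -/
def IsCloseToConvexSet (D : Set ℂ) : Prop :=
  ∃ S : Set (ℂ × ℂ), (∀ p ∈ S, ‖p.2‖ = 1) ∧
    Dᶜ = ⋃ p ∈ S, closedHalfLine p.1 p.2 ∧
    S.PairwiseDisjoint fun p => openHalfLine p.1 p.2

/-- The harmonic function `h + conj g`. -/
def harmonicMap (h g : ℂ → ℂ) : ℂ → ℂ := fun z => h z + conj (g z)

/-! On a smaller disk $|z|<r$ the Herglotz representation splits $1+zh''/h'$ into two parts of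
nonnegative real part, with values $1+b$ and $b$ at $0$, where $1+2b$ is the mean of
$|\mathrm{Re}(1+zh''/h')|$, so $4b\le K-2$. Integrating, $h'=e^{T_1-T_2}$ with
$\mathrm{Re}(1+b+zT_1')>0$ and $\mathrm{Re}(b+zT_2')\ge0$. The function $\varphi$ with
$\varphi'=e^{T_1/(1+b)+iv}$ is then convex, and $h'/\varphi'=e^{N-iv}$ with $N=\frac b{1+b}T_1-T_2$.
On each circle $\mathrm{Im}\,N$ oscillates by at most $2\pi b$, so for the middle value $v$ one has
$|\mathrm{Im}\,N-v|\le\pi b\le\pi/2-\delta\pi/4$. Together with $|z|<1$ this yields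
$|g'/\varphi'|<\mathrm{Re}(h'/\varphi')$.

Hence $G=f\circ\varphi^{-1}$ is strictly monotone on a bounded convex domain $\Omega$: $\langle
G(x)-G(y),x-y\rangle>0$ for $x\ne y$. Injectivity is immediate. For the complement, every $w$ has
some $p\in\overline\Omega$ with $\langle w-G(x),p-x\rangle\ge0$ on $\Omega$. By Minty's lemma $p$ is
a boundary point when $w$ is omitted by $G$, and the ray from $w$ along an outward normal at $p$ is
then omitted too. Monotonicity prevents two such rays from crossing transversally.

Letting the radius tend to $1$, compactness of the unit circle gives limiting rays
(`HasNoncrossingRays.iInter`). Rays overlapping on a common line are finally merged into rays with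
disjoint interiors (`HasNoncrossingRays.isCloseToConvexSet_compl`). -/

/-! ### Monotone maps and variational inequalities. -/

section Monotone

variable {E : Type*} [NormedAddCommGroup E] [InnerProductSpace ℝ E]

/-- If the image of the simplex missed the nonnegative orthant, a separating functional would have
nonnegative coefficients $\mu$. Normalized, $\mu$ is itself a point of the simplex, so
$\mu^TA\mu<0$, against $A+A^T\ge0$ entrywise. -/
theorem exists_mem_stdSimplex_mulVec_nonneg {ι : Type*} [Fintype ι] [Nonempty ι]
    (A : Matrix ι ι ℝ) (hA : ∀ i j, 0 ≤ A i j + A j i) :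
    ∃ c ∈ stdSimplex ℝ ι, ∀ i, 0 ≤ A.mulVec c i := by
  classical
  by_contra! hcon
  obtain ⟨f, u, v, hfu, huv, hfv⟩ := geometric_hahn_banach_compact_closed
    (s := A.mulVecLin '' stdSimplex ℝ ι) (t := {b : ι → ℝ | ∀ i, 0 ≤ b i})
    ((convex_stdSimplex ℝ ι).linear_image _)
    ((isCompact_stdSimplex ℝ ι).image A.mulVecLin.continuous_of_finiteDimensional)
    (fun b hb b' hb' s t hs ht _ i => by
      have h1 := hb i
      have h2 := hb' i
      simp only [Pi.add_apply, Pi.smul_apply, smul_eq_mul]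
      positivity)
    (by
      rw [Set.ofPred_forall]
      exact isClosed_iInter fun i => isClosed_le continuous_const (continuous_apply i))
    (by
      rw [Set.disjoint_left]
      rintro _ ⟨c, hc, rfl⟩ hb
      obtain ⟨i, hi⟩ := hcon c hc
      exact absurd (hb i) (not_le.2 hi))
  have hv0 : v < 0 := by simpa using hfv 0 (fun i => le_rfl)
  have hneg : ∀ c ∈ stdSimplex ℝ ι, f (A.mulVec c) < 0 := fun c hc =>
    (hfu _ ⟨c, hc, rfl⟩).trans (huv.trans hv0)
  set μ : ι → ℝ := fun i => f (Pi.single i 1) with hμ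
  have hf : ∀ b : ι → ℝ, f b = ∑ i, μ i * b i := by
    intro b
    conv_lhs => rw [← Finset.univ_sum_single b]
    rw [map_sum]
    refine Finset.sum_congr rfl fun i _ => ?_
    have : (Pi.single i (b i) : ι → ℝ) = b i • Pi.single i (1 : ℝ) := by
      rw [← Pi.single_smul, smul_eq_mul, mul_one]
    rw [this, map_smul, smul_eq_mul, mul_comm]
  have hμ0 : ∀ i, 0 ≤ μ i := by
    intro i
    by_contra! h
    -- The multiple is chosen so that $f$ takes exactly the value $v$ at a point of the orthant.
    have h1 := hfv ((v / μ i) • Pi.single i (1 : ℝ)) (by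
      intro j
      have h2 : 0 ≤ v / μ i := div_nonneg_of_nonpos hv0.le h.le
      by_cases hij : j = i
      · subst hij; simpa using h2
      · simp [hij])
    rw [map_smul, smul_eq_mul, div_mul_cancel₀ _ h.ne] at h1
    exact lt_irrefl _ h1
  have hsum : 0 < ∑ i, μ i := by
    obtain ⟨i₀⟩ := ‹Nonempty ι›
    refine lt_of_le_of_ne (Finset.sum_nonneg fun i _ => hμ0 i) fun h => ?_
    have h1 := (Finset.sum_eq_zero_iff_of_nonneg fun i _ => hμ0 i).1 h.symm
    have h2 := hneg _ (single_mem_stdSimplex ℝ i₀)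
    rw [hf, Finset.sum_eq_zero fun i hi => by rw [h1 i hi, zero_mul]] at h2
    exact lt_irrefl _ h2
  have hc : (∑ i, μ i)⁻¹ • μ ∈ stdSimplex ℝ ι := by
    refine ⟨fun i => mul_nonneg (inv_nonneg.2 hsum.le) (hμ0 i), ?_⟩
    simp only [Pi.smul_apply, smul_eq_mul, ← Finset.mul_sum]
    exact inv_mul_cancel₀ hsum.ne'
  have h1 := hneg _ hc
  rw [Matrix.mulVec_smul, map_smul, smul_eq_mul] at h1
  have h2 : 0 ≤ f (A.mulVec μ) := by
    have h3 : f (A.mulVec μ) = ∑ i, ∑ j, μ i * μ j * A i j := by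
      rw [hf]
      refine Finset.sum_congr rfl fun i _ => ?_
      rw [Matrix.mulVec, dotProduct, Finset.mul_sum]
      exact Finset.sum_congr rfl fun j _ => by ring
    have h4 : f (A.mulVec μ) + f (A.mulVec μ) = ∑ i, ∑ j, μ i * μ j * (A i j + A j i) := by
      have h4 : f (A.mulVec μ) = ∑ i, ∑ j, μ i * μ j * A j i := by
        rw [h3, Finset.sum_comm]
        exact Finset.sum_congr rfl fun i _ => Finset.sum_congr rfl fun j _ => by ring
      nth_rewrite 1 [h3]
      rw [h4, ← Finset.sum_add_distrib]
      refine Finset.sum_congr rfl fun i _ => ?_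
      rw [← Finset.sum_add_distrib]
      exact Finset.sum_congr rfl fun j _ => by ring
    have h5 : 0 ≤ ∑ i, ∑ j, μ i * μ j * (A i j + A j i) :=
      Finset.sum_nonneg fun i _ => Finset.sum_nonneg fun j _ =>
        mul_nonneg (mul_nonneg (hμ0 i) (hμ0 j)) (hA i j)
    linarith
  exact absurd h1 (not_lt.2 (mul_nonneg (inv_nonneg.2 hsum.le) h2))

/-- A monotone map on a convex set with compact closure solves the variational inequality
for every right-hand side. -/
theorem exists_mem_closure_forall_inner_nonneg {Ω : Set E} (hΩ : Convex ℝ Ω)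
    (hc : IsCompact (closure Ω)) (hne : Ω.Nonempty) {G : E → E}
    (hG : ∀ x ∈ Ω, ∀ y ∈ Ω, 0 ≤ inner ℝ (G x - G y) (x - y)) (w : E) :
    ∃ p ∈ closure Ω, ∀ x ∈ Ω, 0 ≤ inner ℝ (w - G x) (p - x) := by
  -- By compactness finitely many $x$ suffice. For these, $p$ is sought as a convex combination of
  -- the $x$ themselves, and monotonicity is the sign condition on $A+A^T$.
  have key : (closure Ω ∩ ⋂ x : Ω, {p : E | 0 ≤ inner ℝ (w - G x) (p - (x : E))}).Nonempty := by
    refine hc.inter_iInter_nonempty _ (fun x => isClosed_le continuous_const (by fun_prop)) ?_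
    intro u
    rcases u.eq_empty_or_nonempty with rfl | hu
    · simpa using hne
    have : Nonempty u := hu.to_subtype
    obtain ⟨c, hc, hA⟩ := exists_mem_stdSimplex_mulVec_nonneg
      (ι := u) (Matrix.of fun i j => inner ℝ (w - G i) ((j : E) - (i : E))) (fun i j => by
        have h := hG i i.1.2 j j.1.2
        have : inner ℝ (w - G i) ((j : E) - (i : E)) + inner ℝ (w - G j) ((i : E) - (j : E))
          = inner ℝ (G i - G j) ((i : E) - (j : E)) := by
          simp only [inner_sub_left, inner_sub_right]; ring
        simpa [this] using h)
    refine ⟨∑ j, c j • (j : E), subset_closure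
      (hΩ.sum_mem (fun i _ => hc.1 i) hc.2 fun i _ => i.1.2), ?_⟩
    simp only [Set.mem_iInter, Set.mem_ofPred_eq]
    intro i hi
    have h := hA ⟨i, hi⟩
    have h2 : (∑ j, c j • (j : E)) - (i : E) = ∑ j, c j • ((j : E) - (i : E)) := by
      simp only [smul_sub, Finset.sum_sub_distrib, ← Finset.sum_smul, hc.2, one_smul]
    rw [h2, inner_sum]
    simpa [Matrix.mulVec, dotProduct, inner_smul_right, mul_comm] using h
  obtain ⟨p, hp, hp'⟩ := key
  exact ⟨p, hp, fun x hx => by simpa using Set.mem_iInter.1 hp' ⟨x, hx⟩⟩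

/-- Solutions of the variational inequalities of a monotone map form a monotone relation. -/
theorem inner_nonneg_of_forall_inner_nonneg {Ω : Set E} (hΩ : Convex ℝ Ω) (ho : IsOpen Ω)
    (hne : Ω.Nonempty) {G : E → E}
    (hG : ∀ x ∈ Ω, ∀ y ∈ Ω, 0 ≤ inner ℝ (G x - G y) (x - y)) {p q a b : E}
    (hp : p ∈ closure Ω) (hq : q ∈ closure Ω)
    (ha : ∀ x ∈ Ω, 0 ≤ inner ℝ (a - G x) (p - x))
    (hb : ∀ x ∈ Ω, 0 ≤ inner ℝ (b - G x) (q - x)) : 0 ≤ inner ℝ (a - b) (p - q) := by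
  obtain ⟨c, hc⟩ := hne
  -- Both inequalities are tested at the midpoint of $p$ and $q$, moved by $\eta u$ into $\Omega$.
  -- Monotonicity against the fixed point $c$ bounds the $G$-term uniformly as $\eta\to0$, so no
  -- continuity of $G$ is needed.
  set m : E := (2⁻¹ : ℝ) • p + (2⁻¹ : ℝ) • q with hm
  have hmem : m ∈ closure Ω := hΩ.closure hp hq (by norm_num) (by norm_num) (by norm_num)
  set u : E := c - m with hu
  have hx : ∀ η ∈ Set.Ioo (0 : ℝ) 1, m + η • u ∈ Ω := by
    intro η hη
    have := hΩ.combo_interior_closure_mem_interior (ho.interior_eq.symm ▸ hc) hmem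
      hη.1 (by linarith [hη.2] : (0 : ℝ) ≤ 1 - η) (by ring)
    rw [ho.interior_eq] at this
    convert this using 1
    rw [hu]; module
  have key : ∀ η ∈ Set.Ioo (0 : ℝ) 1,
      η * (inner ℝ (a + b) u - 2 * inner ℝ (G c) u) ≤ inner ℝ (a - b) (p - q) / 2 := by
    intro η hη
    have h1 := ha _ (hx η hη)
    have h2 := hb _ (hx η hη)
    have h3 := hG c hc _ (hx η hη)
    have e1 : p - (m + η • u) = (2⁻¹ : ℝ) • (p - q) - η • u := by rw [hm]; module
    have e2 : q - (m + η • u) = -((2⁻¹ : ℝ) • (p - q)) - η • u := by rw [hm]; module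
    have e3 : c - (m + η • u) = (1 - η) • u := by rw [hu]; module
    rw [e1] at h1
    rw [e2] at h2
    rw [e3, inner_smul_right, inner_sub_left] at h3
    have h4 : 0 ≤ inner ℝ (G c) u - inner ℝ (G (m + η • u)) u :=
      nonneg_of_mul_nonneg_right h3 (by linarith [hη.2])
    have h5 := mul_nonneg hη.1.le h4
    simp only [inner_sub_left, inner_sub_right, inner_smul_right, inner_neg_right,
      inner_add_left] at h1 h2 h5 ⊢
    linarith
  have hlim : Filter.Tendsto
      (fun η : ℝ => η * (inner ℝ (a + b) u - 2 * inner ℝ (G c) u))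
      (nhdsWithin 0 (Set.Ioi 0)) (nhds 0) := by
    have : Continuous fun η : ℝ => η * (inner ℝ (a + b) u - 2 * inner ℝ (G c) u) := by fun_prop
    simpa using (this.tendsto 0).mono_left nhdsWithin_le_nhds
  have := le_of_tendsto hlim
    (Filter.eventually_of_mem (Ioo_mem_nhdsGT (zero_lt_one)) key)
  linarith

/-- Minty's lemma. -/
theorem eq_of_forall_inner_nonneg {Ω : Set E} (ho : IsOpen Ω) {G : E → E}
    (hG : ContinuousOn G Ω) {p w : E} (hp : p ∈ Ω)
    (hw : ∀ x ∈ Ω, 0 ≤ inner ℝ (w - G x) (p - x)) : w = G p := by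
  rw [← sub_eq_zero, ← real_inner_self_nonpos]
  -- Test at $p+te$, divide by $t$ and let $t\to0^+$ to get $\|e\|^2\le0$.
  set e : E := w - G p
  have hlim : Filter.Tendsto (fun t : ℝ => p + t • e) (nhdsWithin 0 (Set.Ioi 0)) (nhds p) := by
    have : Continuous fun t : ℝ => p + t • e := by fun_prop
    simpa using (this.tendsto 0).mono_left nhdsWithin_le_nhds
  have hlim2 : Filter.Tendsto (fun t : ℝ => inner ℝ (w - G (p + t • e)) e)
      (nhdsWithin 0 (Set.Ioi 0)) (nhds (inner ℝ (w - G p) e)) :=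
    (tendsto_const_nhds.sub ((hG.continuousAt (ho.mem_nhds hp)).tendsto.comp hlim)).inner
      tendsto_const_nhds
  refine le_of_tendsto hlim2 ?_
  filter_upwards [self_mem_nhdsWithin, hlim (ho.mem_nhds hp)] with t ht hmem
  have h := hw _ hmem
  rw [show p - (p + t • e) = -(t • e) by abel, inner_neg_right, inner_smul_right] at h
  have ht' : 0 < t := ht
  by_contra! h2
  have := mul_pos ht' h2
  linarith

end Monotone

/-! ### Rays omitted by a monotone map. -/

/-- Through every point of `C` there is a ray inside `C`, and these rays do not cross
transversally. -/
def HasNoncrossingRays (C : Set ℂ) : Prop :=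
  ∃ d : ℂ → ℂ, (∀ w ∈ C, ‖d w‖ = 1) ∧ (∀ w ∈ C, closedHalfLine w (d w) ⊆ C) ∧
    ∀ w ∈ C, ∀ w' ∈ C, (conj (d w) * d w').im ≠ 0 →
      Disjoint (openHalfLine w (d w)) (openHalfLine w' (d w'))

theorem Convex.exists_unit_normal {Ω : Set ℂ} (hΩ : Convex ℝ Ω) (ho : IsOpen Ω)
    (hne : Ω.Nonempty) {p : ℂ} (hp : p ∉ Ω) :
    ∃ n : ℂ, ‖n‖ = 1 ∧ ∀ x ∈ Ω, inner ℝ n x ≤ inner ℝ n p := by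
  obtain ⟨f, hf⟩ := geometric_hahn_banach_open_point hΩ ho hp
  set m : ℂ := (InnerProductSpace.toDual ℝ ℂ).symm f with hm
  have hmf : ∀ x, inner ℝ m x = f x := fun x => InnerProductSpace.toDual_symm_apply
  have hm0 : m ≠ 0 := by
    rintro h
    obtain ⟨x, hx⟩ := hne
    have := hf x hx
    rw [← hmf, ← hmf, h, inner_zero_left, inner_zero_left] at this
    exact lt_irrefl _ this
  refine ⟨(‖m‖⁻¹ : ℝ) • m, by rw [norm_smul, norm_inv, norm_norm, inv_mul_cancel₀ (by simpa)], ?_⟩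
  intro x hx
  rw [real_inner_smul_left, real_inner_smul_left, hmf, hmf]
  exact mul_le_mul_of_nonneg_left (hf x hx).le (by positivity)

theorem im_conj_mul_eq_zero_of_inner_eq_zero {m n e : ℂ} (he : e ≠ 0) (hm : inner ℝ m e = 0)
    (hn : inner ℝ n e = 0) : (conj m * n).im = 0 := by
  rw [Complex.inner] at hm hn
  simp only [Complex.mul_re, Complex.mul_im, Complex.conj_re, Complex.conj_im] at *
  by_contra h
  apply he
  apply Complex.ext
  · refine (mul_eq_zero.1 (?_ : (m.re * n.im + -m.im * n.re) * e.re = 0)).resolve_left h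
    linear_combination n.im * hm - m.im * hn
  · refine (mul_eq_zero.1 (?_ : (m.re * n.im + -m.im * n.re) * e.im = 0)).resolve_left h
    linear_combination m.re * hn - n.re * hm

/-- The range of a strictly monotone continuous map on a bounded convex domain is the complement
of a system of noncrossing rays. -/
theorem hasNoncrossingRays_compl_image {Ω : Set ℂ} (hΩ : Convex ℝ Ω) (ho : IsOpen Ω)
    (hne : Ω.Nonempty) (hb : Bornology.IsBounded Ω) {G : ℂ → ℂ} (hGc : ContinuousOn G Ω)
    (hG : ∀ x ∈ Ω, ∀ y ∈ Ω, x ≠ y → 0 < inner ℝ (G x - G y) (x - y)) :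
    HasNoncrossingRays (G '' Ω)ᶜ := by
  have hG0 : ∀ x ∈ Ω, ∀ y ∈ Ω, 0 ≤ inner ℝ (G x - G y) (x - y) := by
    intro x hx y hy
    rcases eq_or_ne x y with rfl | h
    · simp
    · exact (hG x hx y hy h).le
  choose p hpcl hp using exists_mem_closure_forall_inner_nonneg hΩ hb.isCompact_closure hne hG0
  have hpΩ : ∀ w ∈ (G '' Ω)ᶜ, p w ∉ Ω := fun w hw h =>
    hw ⟨p w, h, (eq_of_forall_inner_nonneg ho hGc h (hp w)).symm⟩
  choose! n hn1 hn using fun (q : ℂ) (hq : q ∉ Ω) => hΩ.exists_unit_normal ho hne hq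
  have hncl : ∀ q ∉ Ω, ∀ x ∈ closure Ω, inner ℝ (n q) x ≤ inner ℝ (n q) q := fun q hq x hx =>
    closure_minimal (t := {x | inner ℝ (n q) x ≤ inner ℝ (n q) q}) (hn q hq)
      (isClosed_le (by fun_prop) continuous_const) hx
  refine ⟨fun w => n (p w), fun w hw => hn1 _ (hpΩ w hw), ?_, ?_⟩
  -- Adding a multiple of the outward normal preserves the variational inequality with the same $p$.
  -- If the new point were $G(x_0)$, testing at the midpoint of $x_0$ and $p$ would contradict
  -- strict monotonicity.
  · rintro w hw _ ⟨t, ht, rfl⟩ ⟨x₀, hx₀, hx₀'⟩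
    have h1 : ∀ x ∈ Ω, 0 ≤ inner ℝ (G x₀ - G x) (p w - x) := by
      intro x hx
      have h2 := hn _ (hpΩ w hw) x hx
      have h3 := hp w x hx
      rw [hx₀', show w + t * n (p w) - G x = (w - G x) + t • n (p w) by
        rw [Complex.real_smul]; ring, inner_add_left, real_inner_smul_left, inner_sub_right (n (p w))]
      have := mul_nonneg ht (sub_nonneg.2 h2)
      linarith
    have hne' : x₀ ≠ p w := fun h => hpΩ w hw (h ▸ hx₀)
    set x : ℂ := (2⁻¹ : ℝ) • x₀ + (2⁻¹ : ℝ) • p w with hx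
    have hxΩ : x ∈ Ω := by
      have := hΩ.combo_interior_closure_mem_interior (ho.interior_eq.symm ▸ hx₀) (hpcl w)
        (by norm_num : (0 : ℝ) < 2⁻¹) (by norm_num : (0 : ℝ) ≤ 2⁻¹) (by norm_num)
      rwa [ho.interior_eq] at this
    have e1 : p w - x = (2⁻¹ : ℝ) • (p w - x₀) := by rw [hx]; module
    have e2 : x₀ - x = -((2⁻¹ : ℝ) • (p w - x₀)) := by rw [hx]; module
    have h2 := h1 x hxΩ
    have h3 := hG x₀ hx₀ x hxΩ (by
      intro h
      rw [← sub_eq_zero, e2, neg_eq_zero, smul_eq_zero, sub_eq_zero] at h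
      exact h.elim (by norm_num) fun h => hne' h.symm)
    rw [e2, inner_neg_right, ← e1] at h3
    linarith
  · intro a ha b hb him
    rw [Set.disjoint_left]
    rintro _ ⟨s, hs, rfl⟩ ⟨t, ht, hst⟩
    dsimp only at hst him
    have hmono := inner_nonneg_of_forall_inner_nonneg hΩ ho hne hG0 (hpcl a) (hpcl b) (hp a) (hp b)
    have h1 := hncl _ (hpΩ a ha) _ (hpcl b)
    have h2 := hncl _ (hpΩ b hb) _ (hpcl a)
    have e : a - b = t • n (p b) - s • n (p a) := by
      rw [Complex.real_smul, Complex.real_smul]; linear_combination hst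
    -- At a crossing, $a-b=t\,n_b-s\,n_a$. The normals give $\langle
    -- n_b,p_a-p_b\rangle\le0\le\langle n_a,p_a-p_b\rangle$, while monotonicity of the relation
    -- demands the opposite sign of the combination.
    have h3 : inner ℝ (n (p a)) (p a - p b) = 0 ∧ inner ℝ (n (p b)) (p a - p b) = 0 := by
      have h4 : 0 ≤ inner ℝ (n (p a)) (p a - p b) := by rw [inner_sub_right]; linarith
      have h5 : inner ℝ (n (p b)) (p a - p b) ≤ 0 := by rw [inner_sub_right]; linarith
      rw [e, inner_sub_left, real_inner_smul_left, real_inner_smul_left] at hmono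
      have h6 := mul_nonneg hs.le h4
      have h7 := mul_nonneg ht.le (neg_nonneg.2 h5)
      constructor
      · exact (mul_eq_zero.1 (by linarith : s * inner ℝ (n (p a)) (p a - p b) = 0)).resolve_left
          hs.ne'
      · exact (mul_eq_zero.1 (by linarith : t * inner ℝ (n (p b)) (p a - p b) = 0)).resolve_left
          ht.ne'
    refine him (im_conj_mul_eq_zero_of_inner_eq_zero (fun h => him ?_) h3.1 h3.2)
    rw [sub_eq_zero.1 h, Complex.conj_mul']
    norm_cast

/-! ### Limits of noncrossing ray systems. -/

/-- Cramer's rule: the parameters at which two transversal lines meet are explicit quotients,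
continuous in the directions. -/
theorem sub_mul_im_conj_mul (w w' d d' : ℂ) :
    (w - w') * ((conj d * d').im : ℂ) =
      ((conj d * (w - w')).im : ℂ) * d' - ((conj d' * (w - w')).im : ℂ) * d := by
  apply Complex.ext <;> simp <;> ring

/-- Directions converge along an ultrafilter because the unit circle is compact, and closedness
keeps the limit rays inside each `C m`. A transversal crossing of open rays is stable under small
changes of direction, so a crossing in the limit would already occur for some `n`. -/
theorem HasNoncrossingRays.iInter {C : ℕ → Set ℂ} (hanti : Antitone C)
    (hcl : ∀ n, IsClosed (C n)) (hC : ∀ n, HasNoncrossingRays (C n)) :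
    HasNoncrossingRays (⋂ n, C n) := by
  choose d hd1 hd2 hd3 using hC
  have hlim : ∀ w ∈ ⋂ n, C n, ∃ D : ℂ, ‖D‖ = 1 ∧
      Filter.Tendsto (fun n => d n w) (Filter.hyperfilter ℕ) (nhds D) := by
    intro w hw
    obtain ⟨D, hD, hle⟩ := (isCompact_sphere (0 : ℂ) 1).ultrafilter_le_nhds
      ((Filter.hyperfilter ℕ).map fun n => d n w) (by
        rw [Ultrafilter.coe_map, Filter.le_principal_iff, Filter.mem_map]
        exact Filter.Eventually.of_forall fun n => by
          simpa using hd1 n w (Set.mem_iInter.1 hw n))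
    exact ⟨D, by simpa using hD, hle⟩
  choose! D hD1 hD using hlim
  refine ⟨D, hD1, ?_, ?_⟩
  · rintro w hw _ ⟨t, ht, rfl⟩
    refine Set.mem_iInter.2 fun m => ?_
    have h1 : Filter.Tendsto (fun n => w + t * d n w) (Filter.hyperfilter ℕ)
        (nhds (w + t * D w)) := ((hD w hw).const_mul _).const_add _
    refine (hcl m).mem_of_tendsto h1 ?_
    filter_upwards [Nat.hyperfilter_le_atTop (Filter.eventually_ge_atTop m)] with n hn
    exact hanti hn (hd2 n w (Set.mem_iInter.1 hw n) ⟨t, ht, rfl⟩)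
  · intro w hw w' hw' him
    rw [Set.disjoint_left]
    rintro _ ⟨s, hs, rfl⟩ ⟨s', hs', hss⟩
    set Δ : ℝ := (conj (D w) * D w').im with hΔ
    have e0 : w - w' = s' * D w' - s * D w := by linear_combination hss
    have e1 : (conj (D w) * (w - w')).im / Δ = s' := by
      rw [div_eq_iff him, e0, hΔ]; simp; ring
    have e2 : (conj (D w') * (w - w')).im / Δ = s := by
      rw [div_eq_iff him, e0, hΔ]; simp; ring
    have c1 := (Complex.continuous_conj.tendsto _).comp (hD w hw)
    have c2 := (Complex.continuous_conj.tendsto _).comp (hD w' hw')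
    have tΔ := (Complex.continuous_im.tendsto _).comp (c1.mul (hD w' hw'))
    have t1 := ((Complex.continuous_im.tendsto _).comp (c1.mul_const (w - w'))).div tΔ him
    have t2 := ((Complex.continuous_im.tendsto _).comp (c2.mul_const (w - w'))).div tΔ him
    rw [← hΔ, e1] at t1
    rw [← hΔ, e2] at t2
    obtain ⟨n, hn, hn1, hn2⟩ := ((tΔ.eventually_ne him).and
      ((t1.eventually (lt_mem_nhds hs')).and (t2.eventually (lt_mem_nhds hs)))).exists
    simp only [Function.comp_apply, Pi.div_apply] at hn hn1 hn2
    refine Set.disjoint_left.1 (hd3 n w (Set.mem_iInter.1 hw n) w' (Set.mem_iInter.1 hw' n) hn)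
      ⟨_, hn2, rfl⟩ ⟨_, hn1, ?_⟩
    have hn' : ((conj (d n w) * d n w').im : ℂ) ≠ 0 := by exact_mod_cast hn
    have := sub_mul_im_conj_mul w w' (d n w) (d n w')
    rw [Complex.ofReal_div, Complex.ofReal_div]
    refine mul_right_cancel₀ hn' ?_
    rw [add_mul, add_mul, mul_right_comm, div_mul_cancel₀ _ hn', mul_right_comm,
      div_mul_cancel₀ _ hn']
    linear_combination this

theorem eq_or_eq_neg_of_im_conj_mul_eq_zero {d d' : ℂ} (hd : ‖d‖ = 1) (hd' : ‖d'‖ = 1)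
    (h : (conj d * d').im = 0) : d' = d ∨ d' = -d := by
  have h1 : d * conj d = 1 := by rw [Complex.mul_conj', hd]; norm_num
  have h2 : d' = ((conj d * d').re : ℂ) * d := by
    have : ((conj d * d').re : ℂ) = conj d * d' := Complex.ext (by simp) (by simpa using h.symm)
    rw [this]
    linear_combination -d' * h1
  have h3 : |(conj d * d').re| = 1 := by
    have := congrArg norm h2
    rwa [norm_mul, hd, hd', Complex.norm_real, mul_one, Real.norm_eq_abs, eq_comm] at this
  rcases (abs_eq zero_le_one).1 h3 with h4 | h4 <;> rw [h4] at h2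
  · left; simpa using h2
  · right; simpa using h2

/-! ### From noncrossing rays to rays with disjoint interiors. -/

/-- The line through `a` in direction `d`. -/
def fullLine (a d : ℂ) : Set ℂ := {w | ∃ t : ℝ, w = a + t * d}

theorem fullLine_eq_of_mem {a d b d' : ℂ} (hb : b ∈ fullLine a d) (hd : d' = d ∨ d' = -d) :
    fullLine b d' = fullLine a d := by
  obtain ⟨s, rfl⟩ := hb
  ext x
  constructor
  · rintro ⟨t, rfl⟩
    rcases hd with rfl | rfl
    · exact ⟨s + t, by push_cast; ring⟩
    · exact ⟨s - t, by push_cast; ring⟩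
  · rintro ⟨t, rfl⟩
    rcases hd with rfl | rfl
    · exact ⟨t - s, by push_cast; ring⟩
    · exact ⟨s - t, by push_cast; ring⟩

theorem openHalfLine_subset_closedHalfLine (a d : ℂ) : openHalfLine a d ⊆ closedHalfLine a d :=
  fun _ ⟨t, ht, h⟩ => ⟨t, ht.le, h⟩

theorem closedHalfLine_subset_fullLine (a d : ℂ) : closedHalfLine a d ⊆ fullLine a d :=
  fun _ ⟨t, _, h⟩ => ⟨t, h⟩

theorem add_mul_left_injective {d : ℂ} (hd : ‖d‖ = 1) (a : ℂ) {s t : ℝ}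
    (h : a + s * d = a + t * d) : s = t := by
  have h0 : d ≠ 0 := by rintro rfl; simp at hd
  exact_mod_cast mul_right_cancel₀ h0 (add_left_cancel h)

/-- Rays on one line can be rearranged to have disjoint interiors. -/
theorem exists_disjoint_rays_on_line {C : Set ℂ} (hC : IsClosed C) {d : ℂ → ℂ}
    (hd1 : ∀ w ∈ C, ‖d w‖ = 1) (hd2 : ∀ w ∈ C, closedHalfLine w (d w) ⊆ C) {w₀ : ℂ}
    (hw₀ : w₀ ∈ C) :
    ∃ S : Set (ℂ × ℂ), (∀ p ∈ S, ‖p.2‖ = 1) ∧ (∀ p ∈ S, closedHalfLine p.1 p.2 ⊆ C) ∧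
      (∀ w ∈ C, fullLine w (d w) = fullLine w₀ (d w₀) → ∃ p ∈ S, w ∈ closedHalfLine p.1 p.2) ∧
      (S.PairwiseDisjoint fun p => openHalfLine p.1 p.2) ∧
      ∀ p ∈ S, ∀ x ∈ openHalfLine p.1 p.2, ∃ w ∈ C,
        fullLine w (d w) = fullLine w₀ (d w₀) ∧ x ∈ openHalfLine w (d w) := by
  set e : ℂ := d w₀ with he
  have he1 : ‖e‖ = 1 := hd1 w₀ hw₀
  have hline : ∀ w ∈ C, fullLine w (d w) = fullLine w₀ e →
      ∃ t : ℝ, w = w₀ + t * e ∧ (d w = e ∨ d w = -e) := by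
    intro w hw h
    obtain ⟨t, ht⟩ : w ∈ fullLine w₀ e := h ▸ ⟨0, by simp⟩
    obtain ⟨s, hs⟩ : w + d w ∈ fullLine w₀ e := h ▸ ⟨1, by simp⟩
    have h1 : d w = ((s - t : ℝ) : ℂ) * e := by push_cast; linear_combination hs - ht
    have h2 : |s - t| = 1 := by
      have := congrArg norm h1
      rwa [norm_mul, he1, hd1 w hw, Complex.norm_real, mul_one, Real.norm_eq_abs, eq_comm] at this
    refine ⟨t, ht, ?_⟩
    rcases (abs_eq zero_le_one).1 h2 with h4 | h4 <;> rw [h4] at h1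
    · left; simpa using h1
    · right; simpa using h1
  have hclosed : IsClosed {t : ℝ | w₀ + t * e ∈ C} := hC.preimage (by fun_prop)
  -- If open rays cover the line, two opposite rays from $w_0$ replace them all. Otherwise an
  -- uncovered parameter $\tau$ separates the two orientations: rays along $e$ start at or after
  -- $\tau$, rays along $-e$ at or before it. Each orientation then merges into one ray, starting at
  -- `sInf P` or `sSup N`, whose endpoint lies in `C` by closedness.
  by_cases hT : ∀ t : ℝ, ∃ w ∈ C, fullLine w (d w) = fullLine w₀ e ∧
      w₀ + t * e ∈ openHalfLine w (d w)
  · have hall : ∀ t : ℝ, w₀ + t * e ∈ C := fun t => by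
      obtain ⟨w, hw, -, h⟩ := hT t
      exact hd2 w hw (openHalfLine_subset_closedHalfLine _ _ h)
    refine ⟨{(w₀, e), (w₀, -e)}, ?_, ?_, ?_, ?_, ?_⟩
    · rintro p (rfl | rfl) <;> simp [he1]
    · rintro p (rfl | rfl) _ ⟨t, -, rfl⟩
      · exact hall t
      · simpa using hall (-t)
    · intro w hw h
      obtain ⟨t, rfl, -⟩ := hline w hw h
      rcases le_total 0 t with ht | ht
      · exact ⟨(w₀, e), by simp, t, ht, rfl⟩
      · exact ⟨(w₀, -e), by simp, -t, by linarith, by push_cast; ring⟩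
    · have h : Disjoint (openHalfLine w₀ e) (openHalfLine w₀ (-e)) := by
        rw [Set.disjoint_left]
        rintro _ ⟨s, hs, rfl⟩ ⟨t, ht, h⟩
        have := add_mul_left_injective he1 w₀ (s := s) (t := -t) (by rw [h]; push_cast; ring)
        linarith
      rintro p (rfl | rfl) q (rfl | rfl) hpq
      · exact absurd rfl hpq
      · exact h
      · exact h.symm
      · exact absurd rfl hpq
    · rintro p (rfl | rfl) _ ⟨t, -, rfl⟩
      · exact hT t
      · simpa using hT (-t)
  · push Not at hT
    obtain ⟨τ, hτ⟩ := hT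
    set P : Set ℝ := {t | w₀ + t * e ∈ C ∧ d (w₀ + t * e) = e} with hP
    set N : Set ℝ := {t | w₀ + t * e ∈ C ∧ d (w₀ + t * e) = -e} with hN
    have hPl : ∀ t ∈ P, fullLine (w₀ + t * e) (d (w₀ + t * e)) = fullLine w₀ e := fun t ht =>
      fullLine_eq_of_mem ⟨t, rfl⟩ (Or.inl ht.2)
    have hNl : ∀ t ∈ N, fullLine (w₀ + t * e) (d (w₀ + t * e)) = fullLine w₀ e := fun t ht =>
      fullLine_eq_of_mem ⟨t, rfl⟩ (Or.inr ht.2)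
    have hPo : ∀ t ∈ P, ∀ s, t < s → w₀ + s * e ∈ openHalfLine (w₀ + t * e) (d (w₀ + t * e)) :=
      fun t ht s hs => ⟨s - t, by linarith, by rw [ht.2]; push_cast; ring⟩
    have hNo : ∀ t ∈ N, ∀ s, s < t → w₀ + s * e ∈ openHalfLine (w₀ + t * e) (d (w₀ + t * e)) :=
      fun t ht s hs => ⟨t - s, by linarith, by rw [ht.2]; push_cast; ring⟩
    have hPτ : ∀ t ∈ P, τ ≤ t := fun t ht => by
      by_contra! h
      exact hτ _ ht.1 (hPl t ht) (hPo t ht τ h)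
    have hNτ : ∀ t ∈ N, t ≤ τ := fun t ht => by
      by_contra! h
      exact hτ _ ht.1 (hNl t ht) (hNo t ht τ h)
    have hP0 : P.Nonempty := ⟨0, by simpa [hP] using ⟨hw₀, he.symm⟩⟩
    have hPb : BddBelow P := ⟨τ, hPτ⟩
    have hNb : BddAbove N := ⟨τ, hNτ⟩
    have haP : τ ≤ sInf P := le_csInf hP0 hPτ
    have hPC : ∀ t, sInf P ≤ t → w₀ + t * e ∈ C := by
      intro t ht
      rcases ht.eq_or_lt with rfl | h
      · exact closure_minimal (fun t ht => ht.1) hclosed (csInf_mem_closure hP0 hPb)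
      · obtain ⟨s, hs, hst⟩ := exists_lt_of_csInf_lt hP0 h
        exact hd2 _ hs.1 (openHalfLine_subset_closedHalfLine _ _ (hPo s hs t hst))
    have hNC : N.Nonempty → ∀ t, t ≤ sSup N → w₀ + t * e ∈ C := by
      intro hN0 t ht
      rcases ht.eq_or_lt with rfl | h
      · exact closure_minimal (fun t ht => ht.1) hclosed (csSup_mem_closure hN0 hNb)
      · obtain ⟨s, hs, hst⟩ := exists_lt_of_lt_csSup hN0 h
        exact hd2 _ hs.1 (openHalfLine_subset_closedHalfLine _ _ (hNo s hs t hst))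
    refine ⟨{p | p = (w₀ + (sInf P : ℝ) * e, e) ∨
      N.Nonempty ∧ p = (w₀ + (sSup N : ℝ) * e, -e)}, ?_, ?_, ?_, ?_, ?_⟩
    · rintro p (rfl | ⟨-, rfl⟩) <;> simp [he1]
    · rintro p (rfl | ⟨hN0, rfl⟩) _ ⟨t, ht, rfl⟩
      · have := hPC (sInf P + t) (by linarith)
        push_cast at this
        convert this using 1
        ring
      · have := hNC hN0 (sSup N - t) (by linarith)
        push_cast at this
        convert this using 1
        ring
    · intro w hw h
      obtain ⟨t, rfl, ht | ht⟩ := hline w hw h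
      · exact ⟨_, Or.inl rfl, t - sInf P, sub_nonneg.2 (csInf_le hPb ⟨hw, ht⟩), by push_cast; ring⟩
      · exact ⟨_, Or.inr ⟨⟨t, hw, ht⟩, rfl⟩, sSup N - t, sub_nonneg.2 (le_csSup hNb ⟨hw, ht⟩),
          by push_cast; ring⟩
    · have h : N.Nonempty → Disjoint (openHalfLine (w₀ + (sInf P : ℝ) * e) e)
          (openHalfLine (w₀ + (sSup N : ℝ) * e) (-e)) := by
        intro hN0
        have hbN : sSup N ≤ τ := csSup_le hN0 hNτ
        rw [Set.disjoint_left]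
        rintro _ ⟨s, hs, rfl⟩ ⟨t, ht, h⟩
        have := add_mul_left_injective he1 w₀ (s := sInf P + s) (t := sSup N - t)
          (by push_cast; linear_combination h)
        linarith
      rintro p (rfl | ⟨hp, rfl⟩) q (rfl | ⟨hq, rfl⟩) hpq
      · exact absurd rfl hpq
      · exact h hq
      · exact (h hp).symm
      · exact absurd rfl hpq
    · rintro p (rfl | ⟨hN0, rfl⟩) _ ⟨t, ht, rfl⟩
      · obtain ⟨s, hs, hst⟩ := exists_lt_of_csInf_lt hP0 (by linarith : sInf P < sInf P + t)
        refine ⟨_, hs.1, hPl s hs, ?_⟩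
        convert hPo s hs _ hst using 1
        push_cast; ring
      · obtain ⟨s, hs, hst⟩ := exists_lt_of_lt_csSup hN0 (by linarith : sSup N - t < sSup N)
        refine ⟨_, hs.1, hNl s hs, ?_⟩
        convert hNo s hs _ hst using 1
        push_cast; ring

/-- The rays are rearranged line by line. An interior point of a new ray is interior to an old ray
on the same line, so a point shared by two lines would be a crossing of old rays: excluded if
transversal, and forcing equal lines if parallel. -/
theorem HasNoncrossingRays.isCloseToConvexSet_compl {C : Set ℂ} (h : HasNoncrossingRays C)
    (hC : IsClosed C) : IsCloseToConvexSet Cᶜ := by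
  obtain ⟨d, hd1, hd2, hd3⟩ := h
  have key : ∀ l ∈ (fun w => fullLine w (d w)) '' C, ∃ S : Set (ℂ × ℂ),
      (∀ p ∈ S, ‖p.2‖ = 1) ∧ (∀ p ∈ S, closedHalfLine p.1 p.2 ⊆ C) ∧
      (∀ w ∈ C, fullLine w (d w) = l → ∃ p ∈ S, w ∈ closedHalfLine p.1 p.2) ∧
      (S.PairwiseDisjoint fun p => openHalfLine p.1 p.2) ∧
      ∀ p ∈ S, ∀ x ∈ openHalfLine p.1 p.2, ∃ w ∈ C,
        fullLine w (d w) = l ∧ x ∈ openHalfLine w (d w) := by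
    rintro _ ⟨w₀, hw₀, rfl⟩
    exact exists_disjoint_rays_on_line hC hd1 hd2 hw₀
  choose! S hS1 hS2 hS3 hS4 hS5 using key
  refine ⟨⋃ l ∈ (fun w => fullLine w (d w)) '' C, S l, ?_, ?_, ?_⟩
  · intro p hp
    obtain ⟨l, hl, hp⟩ := Set.mem_iUnion₂.1 hp
    exact hS1 l hl p hp
  · rw [compl_compl]
    refine Set.Subset.antisymm (fun w hw => ?_) (Set.iUnion₂_subset fun p hp => ?_)
    · obtain ⟨p, hp, hwp⟩ := hS3 _ ⟨w, hw, rfl⟩ w hw rfl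
      exact Set.mem_iUnion₂.2 ⟨p, Set.mem_iUnion₂.2 ⟨_, ⟨w, hw, rfl⟩, hp⟩, hwp⟩
    · obtain ⟨l, hl, hp⟩ := Set.mem_iUnion₂.1 hp
      exact hS2 l hl p hp
  · intro p hp q hq hpq
    obtain ⟨l, hl, hp⟩ := Set.mem_iUnion₂.1 hp
    obtain ⟨m, hm, hq⟩ := Set.mem_iUnion₂.1 hq
    by_cases hlm : l = m
    · subst hlm
      exact hS4 l hl hp hq hpq
    · refine Set.disjoint_left.2 fun x hxp hxq => hlm ?_
      obtain ⟨w, hw, rfl, hxw⟩ := hS5 l hl p hp x hxp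
      obtain ⟨w', hw', rfl, hxw'⟩ := hS5 m hm q hq x hxq
      by_cases him : (conj (d w) * d w').im = 0
      · have hdd := eq_or_eq_neg_of_im_conj_mul_eq_zero (hd1 w hw) (hd1 w' hw') him
        have h1 : x ∈ fullLine w (d w) :=
          closedHalfLine_subset_fullLine _ _ (openHalfLine_subset_closedHalfLine _ _ hxw)
        have h2 : x ∈ fullLine w' (d w') :=
          closedHalfLine_subset_fullLine _ _ (openHalfLine_subset_closedHalfLine _ _ hxw')
        rw [← fullLine_eq_of_mem h1 hdd, ← fullLine_eq_of_mem h2 (Or.inl rfl)]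
      · exact absurd hxw' (Set.disjoint_left.1 (hd3 w hw w' hw' him) hxw)

/-! ### The maximum principle for real parts, through the modulus of $e^F$. -/

section MaximumPrinciple

theorem diffContOnCl_ball_of_differentiableOn {F : ℂ → ℂ} {R ρ : ℝ}
    (hF : DifferentiableOn ℂ F (Metric.ball 0 R)) (hR : ρ < R) :
    DiffContOnCl ℂ F (Metric.ball 0 ρ) :=
  (hF.mono ((Metric.closure_ball_subset_closedBall).trans
    (Metric.closedBall_subset_ball hR))).diffContOnCl

theorem re_le_of_forall_mem_sphere_re_le {F : ℂ → ℂ} {R ρ M : ℝ}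
    (hF : DifferentiableOn ℂ F (Metric.ball 0 R)) (hρ : 0 < ρ) (hR : ρ < R)
    (hM : ∀ z ∈ Metric.sphere (0 : ℂ) ρ, (F z).re ≤ M) {z : ℂ}
    (hz : z ∈ Metric.closedBall (0 : ℂ) ρ) : (F z).re ≤ M := by
  have h := Complex.norm_le_of_forall_mem_frontier_norm_le (f := fun z => Complex.exp (F z))
    (C := Real.exp M) Metric.isBounded_ball (diffContOnCl_ball_of_differentiableOn hF.cexp hR)
    (by
      rw [frontier_ball _ hρ.ne']
      intro w hw
      rw [Complex.norm_exp]
      exact Real.exp_le_exp.2 (hM w hw)) (by rwa [closure_ball _ hρ.ne'])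
  rw [Complex.norm_exp] at h
  exact Real.exp_le_exp.1 h

theorem re_lt_of_forall_mem_sphere_re_le {F : ℂ → ℂ} {R ρ M : ℝ}
    (hF : DifferentiableOn ℂ F (Metric.ball 0 R)) (hρ : 0 < ρ) (hR : ρ < R)
    (hM : ∀ z ∈ Metric.sphere (0 : ℂ) ρ, (F z).re ≤ M) {z₀ : ℂ}
    (hz₀ : z₀ ∈ Metric.sphere (0 : ℂ) ρ) (h₀ : (F z₀).re < M) {z : ℂ}
    (hz : z ∈ Metric.ball (0 : ℂ) ρ) : (F z).re < M := by
  refine lt_of_le_of_ne (re_le_of_forall_mem_sphere_re_le hF hρ hR hM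
    (Metric.ball_subset_closedBall hz)) fun heq => ?_
  have h := Complex.norm_eqOn_closure_of_isPreconnected_of_isMaxOn (f := fun z => Complex.exp (F z))
    (convex_ball (0 : ℂ) ρ).isPreconnected Metric.isOpen_ball
    (diffContOnCl_ball_of_differentiableOn hF.cexp hR) hz (by
      intro w hw
      simp only [Function.comp_apply, Complex.norm_exp, Set.mem_ofPred_eq, Real.exp_le_exp, heq]
      exact re_le_of_forall_mem_sphere_re_le hF hρ hR hM (Metric.ball_subset_closedBall hw))
  have h2 := h (x := z₀) (by
    rw [closure_ball _ hρ.ne']; exact Metric.sphere_subset_closedBall hz₀)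
  simp only [Function.comp_apply, Complex.norm_exp, Function.const_apply, Real.exp_eq_exp] at h2
  linarith

end MaximumPrinciple

/-! ### Differentiation along circles. -/

section CircleDerivatives

theorem HasDerivAt.comp_circleMap {F : ℂ → ℂ} {F' : ℂ} {ρ t : ℝ}
    (hF : HasDerivAt F F' (circleMap 0 ρ t)) :
    HasDerivAt (fun s => F (circleMap 0 ρ s)) (F' * (circleMap 0 ρ t * Complex.I)) t :=
  hF.comp t (hasDerivAt_circleMap 0 ρ t)

theorem HasDerivAt.im_comp_circleMap {F : ℂ → ℂ} {F' : ℂ} {ρ t : ℝ}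
    (hF : HasDerivAt F F' (circleMap 0 ρ t)) :
    HasDerivAt (fun s => (F (circleMap 0 ρ s)).im) (circleMap 0 ρ t * F').re t := by
  have h := Complex.imCLM.hasFDerivAt.comp_hasDerivAt t hF.comp_circleMap
  refine h.congr_deriv ?_
  simp; ring

theorem HasDerivAt.re_comp_circleMap {F : ℂ → ℂ} {F' : ℂ} {ρ t : ℝ}
    (hF : HasDerivAt F F' (circleMap 0 ρ t)) :
    HasDerivAt (fun s => (F (circleMap 0 ρ s)).re) (-(circleMap 0 ρ t * F').im) t := by
  have h := Complex.reCLM.hasFDerivAt.comp_hasDerivAt t hF.comp_circleMap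
  refine h.congr_deriv ?_
  simp; ring

theorem circleMap_mem_ball_of_lt {R ρ : ℝ} (hρ : 0 ≤ ρ) (hR : ρ < R) (t : ℝ) :
    circleMap 0 ρ t ∈ Metric.ball (0 : ℂ) R :=
  Metric.closedBall_subset_ball hR (circleMap_mem_closedBall 0 hρ t)

theorem exists_mem_Ico_circleMap_eq {ρ : ℝ} (hρ : 0 ≤ ρ) {z : ℂ}
    (hz : z ∈ Metric.sphere (0 : ℂ) ρ) (t₀ : ℝ) :
    ∃ t ∈ Set.Ico t₀ (t₀ + 2 * Real.pi), circleMap 0 ρ t = z := by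
  rw [← abs_of_nonneg hρ, ← range_circleMap] at hz
  obtain ⟨s, rfl⟩ := hz
  obtain ⟨t, ht, hs⟩ := (periodic_circleMap 0 ρ).exists_mem_Ico Real.two_pi_pos s t₀
  exact ⟨t, ht, hs.symm⟩

end CircleDerivatives

/-! ### Convex analytic functions. -/

section Convex

variable {R : ℝ} {φ L L' : ℂ → ℂ}

/-- The tangent argument of a convex function increases along circles. -/
theorem strictMono_add_im_comp_circleMap
    (hL : ∀ z ∈ Metric.ball (0 : ℂ) R, HasDerivAt L (L' z) z) {a : ℝ}
    (hpos : ∀ z ∈ Metric.ball (0 : ℂ) R, 0 < (a + z * L' z).re) {ρ : ℝ} (hρ : 0 ≤ ρ) (hR : ρ < R) :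
    StrictMono fun t : ℝ => a * t + (L (circleMap 0 ρ t)).im := by
  refine strictMono_of_hasDerivAt_pos (f' := fun t => (a + circleMap 0 ρ t * L' (circleMap 0 ρ t)).re)
    (fun t => ?_) fun t => hpos _ (circleMap_mem_ball_of_lt hρ hR t)
  have h := ((hasDerivAt_id t).const_mul a).add
    (hL _ (circleMap_mem_ball_of_lt hρ hR t)).im_comp_circleMap
  refine h.congr_deriv ?_
  simp

/-- Supporting line property of convex functions on circles. -/
theorem re_lt_of_mem_sphere (hφ : ∀ z ∈ Metric.ball (0 : ℂ) R, HasDerivAt φ (Complex.exp (L z)) z)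
    (hL : ∀ z ∈ Metric.ball (0 : ℂ) R, HasDerivAt L (L' z) z)
    (hpos : ∀ z ∈ Metric.ball (0 : ℂ) R, 0 < (1 + z * L' z).re) {ρ : ℝ} (hρ : 0 < ρ) (hR : ρ < R)
    {ζ z : ℂ} (hζ : ζ ∈ Metric.sphere (0 : ℂ) ρ) (hz : z ∈ Metric.sphere (0 : ℂ) ρ) (hne : z ≠ ζ) :
    (conj (ζ * Complex.exp (L ζ)) * φ z).re < (conj (ζ * Complex.exp (L ζ)) * φ ζ).re := by
  obtain ⟨t₀, -, rfl⟩ := exists_mem_Ico_circleMap_eq hρ.le hζ 0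
  obtain ⟨t, ht, rfl⟩ := exists_mem_Ico_circleMap_eq hρ.le hz t₀
  have ht₀ : t₀ < t := lt_of_le_of_ne ht.1 fun h => hne (by rw [h])
  set ψ : ℝ → ℝ := fun t => t + (L (circleMap 0 ρ t)).im with hψ
  have hψm : StrictMono ψ := by
    have := strictMono_add_im_comp_circleMap (a := 1) hL (by simpa using hpos) hρ.le hR
    simpa using this
  have hψp : ψ (t₀ + 2 * Real.pi) = ψ t₀ + 2 * Real.pi := by
    simp only [hψ, periodic_circleMap 0 ρ t₀]; ring
  have hψc : Continuous ψ := continuous_id.add (continuous_iff_continuousAt.2 fun t =>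
    (hL _ (circleMap_mem_ball_of_lt hρ.le hR t)).im_comp_circleMap.continuousAt)
  set ν : ℂ := circleMap 0 ρ t₀ * Complex.exp (L (circleMap 0 ρ t₀)) with hν
  set u : ℝ → ℝ := fun s => (conj ν * φ (circleMap 0 ρ s)).re with hu
  have hpol : ∀ s, circleMap 0 ρ s * Complex.exp (L (circleMap 0 ρ s)) =
      ((ρ * Real.exp (L (circleMap 0 ρ s)).re : ℝ) : ℂ) * Complex.exp ((ψ s : ℝ) * Complex.I) := by
    intro s
    rw [circleMap_zero, ← circleMap_zero]
    conv_lhs => rw [← Complex.re_add_im (L (circleMap 0 ρ s))]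
    rw [Complex.exp_add, circleMap_zero ρ s, hψ]
    push_cast
    rw [add_mul, Complex.exp_add, circleMap_zero ρ s]
    ring
  -- As `ψ` increases by exactly $2\pi$ over one turn, `u` decreases until `ψ` has gained $\pi$ and
  -- then increases back to its initial value.
  have hder : ∀ s, ∃ κ > 0, HasDerivAt u (-(κ * Real.sin (ψ s - ψ t₀))) s := by
    intro s
    refine ⟨(ρ * Real.exp (L (circleMap 0 ρ t₀)).re) * (ρ * Real.exp (L (circleMap 0 ρ s)).re),
      by positivity, ?_⟩
    have h := ((hφ _ (circleMap_mem_ball_of_lt hρ.le hR s)).const_mul (conj ν)).re_comp_circleMap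
    refine h.congr_deriv ?_
    rw [mul_left_comm, hpol, hν, hpol, map_mul, Complex.conj_ofReal, ← Complex.exp_conj, map_mul,
      Complex.conj_ofReal, Complex.conj_I, mul_mul_mul_comm, ← Complex.exp_add,
      ← Complex.ofReal_mul, Complex.im_ofReal_mul]
    congr 2
    rw [show (ψ t₀ : ℂ) * -Complex.I + ψ s * Complex.I = ((ψ s - ψ t₀ : ℝ) : ℂ) * Complex.I by
      push_cast; ring, Complex.exp_ofReal_mul_I_im]
  have huc : Continuous u := continuous_iff_continuousAt.2 fun s => by
    obtain ⟨κ, -, h⟩ := hder s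
    exact h.continuousAt
  have hup : u (t₀ + 2 * Real.pi) = u t₀ := by simp only [hu, periodic_circleMap 0 ρ t₀]
  obtain ⟨t₁, ht₁, hψt₁⟩ : ∃ t₁ ∈ Set.Icc t₀ (t₀ + 2 * Real.pi), ψ t₁ = ψ t₀ + Real.pi :=
    intermediate_value_Icc (by linarith [Real.pi_pos]) hψc.continuousOn
      ⟨by linarith [Real.pi_pos], by rw [hψp]; linarith [Real.pi_pos]⟩
  have hanti : StrictAntiOn u (Set.Icc t₀ t₁) := by
    refine strictAntiOn_of_deriv_neg (convex_Icc _ _) huc.continuousOn fun s hs => ?_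
    rw [interior_Icc] at hs
    obtain ⟨κ, hκ, h⟩ := hder s
    rw [h.deriv]
    have h1 := hψm hs.1
    have h2 := hψm hs.2
    have := Real.sin_pos_of_pos_of_lt_pi (x := ψ s - ψ t₀) (by linarith) (by linarith)
    nlinarith
  have hmono : StrictMonoOn u (Set.Icc t₁ (t₀ + 2 * Real.pi)) := by
    refine strictMonoOn_of_deriv_pos (convex_Icc _ _) huc.continuousOn fun s hs => ?_
    rw [interior_Icc] at hs
    obtain ⟨κ, hκ, h⟩ := hder s
    rw [h.deriv]
    have h1 := hψm hs.1
    have h2 := hψm hs.2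
    have := Real.sin_pos_of_pos_of_lt_pi (x := ψ s - ψ t₀ - Real.pi) (by linarith) (by linarith)
    rw [Real.sin_sub_pi] at this
    nlinarith
  change u t < u t₀
  rcases le_or_gt t t₁ with h | h
  · exact hanti ⟨le_rfl, ht₁.1⟩ ⟨ht₀.le, h⟩ ht₀
  · rw [← hup]
    exact hmono ⟨h.le, ht.2.le⟩ ⟨ht₁.2, le_rfl⟩ ht.2

theorem re_lt_of_mem_closedBall
    (hφ : ∀ z ∈ Metric.ball (0 : ℂ) R, HasDerivAt φ (Complex.exp (L z)) z)
    (hL : ∀ z ∈ Metric.ball (0 : ℂ) R, HasDerivAt L (L' z) z)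
    (hpos : ∀ z ∈ Metric.ball (0 : ℂ) R, 0 < (1 + z * L' z).re) {ρ : ℝ} (hρ : 0 < ρ) (hR : ρ < R)
    {ζ z : ℂ} (hζ : ζ ∈ Metric.sphere (0 : ℂ) ρ) (hz : z ∈ Metric.closedBall (0 : ℂ) ρ)
    (hne : z ≠ ζ) :
    (conj (ζ * Complex.exp (L ζ)) * φ z).re < (conj (ζ * Complex.exp (L ζ)) * φ ζ).re := by
  rcases (mem_closedBall_zero_iff.1 hz).eq_or_lt with h | h
  · exact re_lt_of_mem_sphere hφ hL hpos hρ hR hζ (mem_sphere_zero_iff_norm.2 h) hne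
  · have hζ0 : ζ ≠ 0 := ne_zero_of_mem_sphere hρ.ne' ⟨ζ, hζ⟩
    -- Any point of the circle other than `ζ` would supply the strict inequality that excludes the
    -- constant case.
    refine re_lt_of_forall_mem_sphere_re_le (z₀ := -ζ)
      (F := fun z => conj (ζ * Complex.exp (L ζ)) * φ z)
      (fun z hz => ((hφ z hz).differentiableAt.const_mul _).differentiableWithinAt) hρ hR ?_
      (by simpa using hζ) ?_ (mem_ball_zero_iff.2 h)
    · intro w hw
      rcases eq_or_ne w ζ with rfl | hwζ
      · exact le_rfl
      · exact (re_lt_of_mem_sphere hφ hL hpos hρ hR hζ hw hwζ).le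
    · exact re_lt_of_mem_sphere hφ hL hpos hρ hR hζ (by simpa using hζ) (by
        rw [Ne, neg_eq_self]; exact hζ0)

/-- Of two distinct points, the one of larger modulus is a strict support point on its own circle,
so the values differ. -/
theorem injOn_of_re_pos (hφ : ∀ z ∈ Metric.ball (0 : ℂ) R, HasDerivAt φ (Complex.exp (L z)) z)
    (hL : ∀ z ∈ Metric.ball (0 : ℂ) R, HasDerivAt L (L' z) z)
    (hpos : ∀ z ∈ Metric.ball (0 : ℂ) R, 0 < (1 + z * L' z).re) :
    Set.InjOn φ (Metric.ball 0 R) := by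
  have key : ∀ a ∈ Metric.ball (0 : ℂ) R, ∀ b ∈ Metric.ball (0 : ℂ) R, ‖a‖ ≤ ‖b‖ → φ a = φ b →
      a = b := by
    intro a _ b hb hab h
    by_contra hne
    have hb0 : 0 < ‖b‖ := by
      refine lt_of_le_of_ne (norm_nonneg b) fun h0 => hne ?_
      rw [← h0] at hab
      rw [norm_le_zero_iff.1 hab, norm_eq_zero.1 h0.symm]
    have := re_lt_of_mem_closedBall hφ hL hpos hb0 (mem_ball_zero_iff.1 hb)
      (mem_sphere_zero_iff_norm.2 rfl) (mem_closedBall_zero_iff.2 hab) hne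
    rw [h] at this
    exact lt_irrefl _ this
  intro a ha b hb h
  rcases le_total ‖a‖ ‖b‖ with hab | hab
  · exact key a ha b hb hab h
  · exact (key b hb a ha hab h.symm).symm

theorem isOpen_image_of_hasDerivAt_exp
    (hφ : ∀ z ∈ Metric.ball (0 : ℂ) R, HasDerivAt φ (Complex.exp (L z)) z) {U : Set ℂ}
    (hU : IsOpen U) (hUR : U ⊆ Metric.ball 0 R) : IsOpen (φ '' U) := by
  rw [isOpen_iff_mem_nhds]
  rintro _ ⟨z, hz, rfl⟩
  have han : AnalyticAt ℂ φ z :=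
    DifferentiableOn.analyticAt (s := Metric.ball 0 R)
      (fun w hw => (hφ w hw).differentiableAt.differentiableWithinAt) (Metric.isOpen_ball.mem_nhds (hUR hz))
  have hs := han.hasStrictDerivAt
  rw [(hφ z (hUR hz)).deriv] at hs
  rw [← hs.map_nhds_eq (Complex.exp_ne_zero _)]
  exact Filter.image_mem_map (hU.mem_nhds hz)

/-- Convex functions map concentric disks onto convex domains. -/
theorem convex_image_ball_of_re_pos
    (hφ : ∀ z ∈ Metric.ball (0 : ℂ) R, HasDerivAt φ (Complex.exp (L z)) z)
    (hL : ∀ z ∈ Metric.ball (0 : ℂ) R, HasDerivAt L (L' z) z)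
    (hpos : ∀ z ∈ Metric.ball (0 : ℂ) R, 0 < (1 + z * L' z).re) {ρ : ℝ} (hρ : 0 < ρ) (hR : ρ < R) :
    Convex ℝ (φ '' Metric.ball 0 ρ) := by
  -- The image equals the intersection `W` of the open supporting half-planes: it is open, nonempty
  -- and relatively closed in the connected set `W`, because boundary values $\varphi(\zeta)$
  -- violate their own strict inequality.
  set W : Set ℂ := ⋂ ζ ∈ Metric.sphere (0 : ℂ) ρ,
    {w | (conj (ζ * Complex.exp (L ζ)) * w).re < (conj (ζ * Complex.exp (L ζ)) * φ ζ).re} with hW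
  have hWc : Convex ℝ W := by
    refine convex_iInter₂ fun ζ _ => convex_halfSpace_lt ⟨fun x y => ?_, fun c x => ?_⟩ _
    · rw [mul_add, Complex.add_re]
    · simp; ring
  have hsub : φ '' Metric.ball 0 ρ ⊆ W := by
    rintro _ ⟨z, hz, rfl⟩
    refine Set.mem_iInter₂.2 fun ζ hζ => re_lt_of_mem_closedBall hφ hL hpos hρ hR hζ
      (Metric.ball_subset_closedBall hz) ?_
    rintro rfl
    exact absurd (mem_sphere_zero_iff_norm.1 hζ) (mem_ball_zero_iff.1 hz).ne
  have hφc : ContinuousOn φ (Metric.closedBall 0 ρ) := fun z hz =>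
    (hφ z (Metric.closedBall_subset_ball hR hz)).continuousAt.continuousWithinAt
  have hclosure : closure (φ '' Metric.ball 0 ρ) ⊆ φ '' Metric.closedBall 0 ρ :=
    closure_minimal (Set.image_mono Metric.ball_subset_closedBall)
      ((isCompact_closedBall 0 ρ).image_of_continuousOn hφc).isClosed
  have hsup : W ⊆ φ '' Metric.ball 0 ρ := by
    refine hWc.isPreconnected.subset_of_closure_inter_subset
      (isOpen_image_of_hasDerivAt_exp hφ Metric.isOpen_ball (Metric.ball_subset_ball hR.le)) ?_ ?_
    · have h0 : φ 0 ∈ φ '' Metric.ball 0 ρ := ⟨0, Metric.mem_ball_self hρ, rfl⟩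
      exact ⟨_, hsub h0, h0⟩
    · rintro w ⟨hw, hwW⟩
      obtain ⟨z, hz, rfl⟩ := hclosure hw
      rcases (mem_closedBall_zero_iff.1 hz).eq_or_lt with h | h
      · have := Set.mem_iInter₂.1 hwW z (mem_sphere_zero_iff_norm.2 h)
        rw [Set.mem_ofPred_eq] at this
        exact absurd this (lt_irrefl _)
      · exact ⟨z, mem_ball_zero_iff.2 h, rfl⟩
  rw [Set.Subset.antisymm hsub hsup]
  exact hWc

end Convex

/-! ### Monotonicity of harmonic maps. -/

section HarmonicMonotone

variable {Ω : Set ℂ} {H K H' K' : ℂ → ℂ}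

/-- The inner product is $\mathrm{Re}(q)|e|^2+\mathrm{Re}(re^2)$. Applied to the real differential,
this gives both strict monotonicity and nonsingularity. -/
theorem inner_mul_add_conj_mul_pos {q r e : ℂ} (hqr : ‖r‖ < q.re) (he : e ≠ 0) :
    0 < inner ℝ (q * e + conj (r * e)) e := by
  have h1 : inner ℝ (q * e + conj (r * e)) e = q.re * ‖e‖ ^ 2 + (r * e * e).re := by
    rw [Complex.inner, ← Complex.normSq_eq_norm_sq, Complex.normSq_apply]
    simp
    ring
  have h2 : |(r * e * e).re| ≤ ‖r‖ * ‖e‖ ^ 2 := by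
    refine (Complex.abs_re_le_norm _).trans_eq ?_
    rw [norm_mul, norm_mul]; ring
  have h3 : 0 < (q.re - ‖r‖) * ‖e‖ ^ 2 := by
    have := norm_pos_iff.2 he
    have := sub_pos.2 hqr
    positivity
  have := neg_abs_le (r * e * e).re
  rw [h1]
  linarith

/-- A sense-preserving harmonic map whose analytic part has derivative of large real part is
strictly monotone on convex sets. -/
theorem inner_harmonicMap_sub_pos (hΩ : Convex ℝ Ω) (hH : ∀ x ∈ Ω, HasDerivAt H (H' x) x)
    (hK : ∀ x ∈ Ω, HasDerivAt K (K' x) x) (hHK : ∀ x ∈ Ω, ‖K' x‖ < (H' x).re)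
    {x y : ℂ} (hx : x ∈ Ω) (hy : y ∈ Ω) (hxy : x ≠ y) :
    0 < inner ℝ (harmonicMap H K x - harmonicMap H K y) (x - y) := by
  set e : ℂ := x - y with he
  have he0 : e ≠ 0 := sub_ne_zero.2 hxy
  have hmem : ∀ s ∈ Set.Icc (0 : ℝ) 1, y + s * e ∈ Ω := by
    intro s hs
    have := hΩ hy hx (by linarith [hs.2] : (0 : ℝ) ≤ 1 - s) hs.1 (by ring)
    convert this using 1
    simp only [he, Complex.real_smul]; push_cast; ring
  set u : ℝ → ℝ := fun s => inner ℝ (harmonicMap H K (y + s * e)) e with hu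
  have hder : ∀ s ∈ Set.Icc (0 : ℝ) 1, HasDerivAt u
      (inner ℝ (H' (y + s * e) * e + conj (K' (y + s * e) * e)) e) s := by
    intro s hs
    have hl : HasDerivAt (fun s : ℝ => y + s * e) e s := by
      simpa using ((Complex.ofRealCLM.hasDerivAt (x := s)).mul_const e).const_add y
    have h1 := (hH _ (hmem s hs)).comp s hl
    have h2 := (hK _ (hmem s hs)).comp s hl
    have h3 := h1.add (Complex.conjCLE.toContinuousLinearMap.hasFDerivAt.comp_hasDerivAt s h2)
    have h4 := h3.inner ℝ (hasDerivAt_const s e)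
    simpa [hu, harmonicMap, Function.comp_def] using h4
  have hmono : StrictMonoOn u (Set.Icc 0 1) := by
    refine strictMonoOn_of_deriv_pos (convex_Icc _ _)
      (fun s hs => (hder s hs).continuousAt.continuousWithinAt) fun s hs => ?_
    rw [interior_Icc] at hs
    have hs' := Set.Ioo_subset_Icc_self hs
    rw [(hder s hs').deriv]
    exact inner_mul_add_conj_mul_pos (hHK _ (hmem s hs')) he0
  have := hmono (Set.left_mem_Icc.2 zero_le_one) (Set.right_mem_Icc.2 zero_le_one) zero_lt_one
  simp only [hu, Complex.ofReal_zero, zero_mul, add_zero, Complex.ofReal_one, one_mul,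
    he, add_sub_cancel] at this
  rw [inner_sub_left]
  linarith

theorem isOpen_image_harmonicMap (hΩ : IsOpen Ω) (hH : ∀ x ∈ Ω, HasDerivAt H (H' x) x)
    (hK : ∀ x ∈ Ω, HasDerivAt K (K' x) x) (hHK : ∀ x ∈ Ω, ‖K' x‖ < (H' x).re) :
    IsOpen (harmonicMap H K '' Ω) := by
  have hstrict : ∀ {F F' : ℂ → ℂ}, (∀ x ∈ Ω, HasDerivAt F (F' x) x) → ∀ x ∈ Ω,
      HasStrictFDerivAt F (F' x • (1 : ℂ →L[ℝ] ℂ)) x := by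
    intro F F' hF x hx
    have h := (DifferentiableOn.analyticAt (s := Ω)
      (fun w hw => (hF w hw).differentiableAt.differentiableWithinAt)
      (hΩ.mem_nhds hx)).hasStrictDerivAt
    rw [(hF x hx).deriv] at h
    exact h.complexToReal_fderiv
  rw [isOpen_iff_mem_nhds]
  rintro _ ⟨x, hx, rfl⟩
  set A : ℂ →L[ℝ] ℂ := H' x • (1 : ℂ →L[ℝ] ℂ) +
    Complex.conjCLE.toContinuousLinearMap.comp (K' x • (1 : ℂ →L[ℝ] ℂ)) with hA
  have hG : HasStrictFDerivAt (harmonicMap H K) A x :=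
    (hstrict hH x hx).add
      (Complex.conjCLE.toContinuousLinearMap.hasStrictFDerivAt.comp x (hstrict hK x hx))
  have hAe : ∀ e, A e = H' x * e + conj (K' x * e) := fun e => by simp [hA]
  have hinj : Function.Injective A := by
    refine (injective_iff_map_eq_zero A).2 fun e he => ?_
    by_contra he0
    have := inner_mul_add_conj_mul_pos (hHK x hx) he0
    rw [← hAe, he, inner_zero_left] at this
    exact lt_irrefl _ this
  have hsurj : Function.Surjective A :=
    (LinearMap.injective_iff_surjective (f := (A : ℂ →ₗ[ℝ] ℂ))).1 hinj
  rw [← hG.map_nhds_eq_of_surj (LinearMap.range_eq_top.2 hsurj)]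
  exact Filter.image_mem_map (hΩ.mem_nhds hx)

end HarmonicMonotone

/-! ### Transport to the convex domain $\varphi(\{|z|<\rho\})$. -/

section ConvexComparison

variable {R : ℝ} {φ L L' h g : ℂ → ℂ}

theorem hasDerivAt_invFunOn (hφ : ∀ z ∈ Metric.ball (0 : ℂ) R, HasDerivAt φ (Complex.exp (L z)) z)
    (hinj : Set.InjOn φ (Metric.ball 0 R)) {z : ℂ} (hz : z ∈ Metric.ball (0 : ℂ) R) :
    HasDerivAt (Function.invFunOn φ (Metric.ball 0 R)) (Complex.exp (L z))⁻¹ (φ z) := by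
  set χ := Function.invFunOn φ (Metric.ball 0 R)
  have hχ : ∀ w ∈ Metric.ball (0 : ℂ) R, χ (φ w) = w := hinj.leftInvOn_invFunOn
  have hs := (DifferentiableOn.analyticAt (s := Metric.ball 0 R)
      (fun w hw => (hφ w hw).differentiableAt.differentiableWithinAt)
      (Metric.isOpen_ball.mem_nhds hz)).hasStrictDerivAt
  rw [(hφ z hz).deriv] at hs
  have hmap := hs.map_nhds_eq (Complex.exp_ne_zero _)
  have hball := Metric.isOpen_ball.mem_nhds hz
  have hcont : ContinuousAt χ (φ z) := by
    rw [ContinuousAt, hχ z hz, ← hmap, Filter.tendsto_map'_iff]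
    refine Filter.tendsto_id.congr' ?_
    filter_upwards [hball] with w hw using (hχ w hw).symm
  refine HasDerivAt.of_local_left_inverse hcont (by rw [hχ z hz]; exact hφ z hz)
    (Complex.exp_ne_zero _) ?_
  rw [← hmap, Filter.eventually_map]
  filter_upwards [hball] with w hw
  rw [hχ w hw]

/-- Comparison of a harmonic map with a convex function on a concentric disk. -/
theorem harmonicMap_of_convex_comparison
    (hφ : ∀ z ∈ Metric.ball (0 : ℂ) R, HasDerivAt φ (Complex.exp (L z)) z)
    (hL : ∀ z ∈ Metric.ball (0 : ℂ) R, HasDerivAt L (L' z) z)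
    (hpos : ∀ z ∈ Metric.ball (0 : ℂ) R, 0 < (1 + z * L' z).re) {ρ : ℝ} (hρ : 0 < ρ) (hR : ρ < R)
    (hh : DifferentiableOn ℂ h (Metric.ball 0 ρ)) (hg : DifferentiableOn ℂ g (Metric.ball 0 ρ))
    (hcomp : ∀ z ∈ Metric.ball (0 : ℂ) ρ,
      ‖deriv g z / Complex.exp (L z)‖ < (deriv h z / Complex.exp (L z)).re) :
    Set.InjOn (harmonicMap h g) (Metric.ball 0 ρ) ∧ IsOpen (harmonicMap h g '' Metric.ball 0 ρ) ∧
      HasNoncrossingRays (harmonicMap h g '' Metric.ball 0 ρ)ᶜ := by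
  have hsubR : Metric.ball (0 : ℂ) ρ ⊆ Metric.ball 0 R := Metric.ball_subset_ball hR.le
  have hinj : Set.InjOn φ (Metric.ball 0 ρ) := (injOn_of_re_pos hφ hL hpos).mono hsubR
  have hΩc := convex_image_ball_of_re_pos hφ hL hpos hρ hR
  have hΩo : IsOpen (φ '' Metric.ball 0 ρ) :=
    isOpen_image_of_hasDerivAt_exp hφ Metric.isOpen_ball hsubR
  set Ω : Set ℂ := φ '' Metric.ball 0 ρ with hΩ
  have hΩb : Bornology.IsBounded Ω := by
    have hφc : ContinuousOn φ (Metric.closedBall 0 ρ) := fun z hz =>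
      (hφ z (Metric.closedBall_subset_ball hR hz)).continuousAt.continuousWithinAt
    exact ((isCompact_closedBall 0 ρ).image_of_continuousOn hφc).isBounded.subset
      (Set.image_mono Metric.ball_subset_closedBall)
  set χ : ℂ → ℂ := Function.invFunOn φ (Metric.ball 0 ρ)
  have hχ : ∀ w ∈ Metric.ball (0 : ℂ) ρ, χ (φ w) = w := hinj.leftInvOn_invFunOn
  have hχmem : ∀ x ∈ Ω, χ x ∈ Metric.ball (0 : ℂ) ρ := by
    rintro _ ⟨z, hz, rfl⟩
    rwa [hχ z hz]
  have hχd : ∀ x ∈ Ω, HasDerivAt χ (Complex.exp (L (χ x)))⁻¹ x := by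
    rintro _ ⟨z, hz, rfl⟩
    rw [hχ z hz]
    exact hasDerivAt_invFunOn (fun z hz => hφ z (hsubR hz)) hinj hz
  have hcompd : ∀ {F : ℂ → ℂ}, DifferentiableOn ℂ F (Metric.ball 0 ρ) → ∀ x ∈ Ω,
      HasDerivAt (F ∘ χ) (deriv F (χ x) / Complex.exp (L (χ x))) x := by
    intro F hF x hx
    exact ((hF.differentiableAt (Metric.isOpen_ball.mem_nhds (hχmem x hx))).hasDerivAt).comp x
      (hχd x hx)
  have hmono : ∀ x ∈ Ω, ∀ y ∈ Ω, x ≠ y →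
      0 < inner ℝ (harmonicMap (h ∘ χ) (g ∘ χ) x - harmonicMap (h ∘ χ) (g ∘ χ) y) (x - y) :=
    fun x hx y hy hxy => inner_harmonicMap_sub_pos hΩc (hcompd hh) (hcompd hg)
      (fun x hx => hcomp _ (hχmem x hx)) hx hy hxy
  have himage : harmonicMap (h ∘ χ) (g ∘ χ) '' Ω = harmonicMap h g '' Metric.ball 0 ρ := by
    rw [hΩ, Set.image_image]
    refine Set.image_congr fun z hz => ?_
    simp only [harmonicMap, Function.comp_apply, hχ z hz]
  have hcont : ContinuousOn (harmonicMap (h ∘ χ) (g ∘ χ)) Ω := fun x hx =>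
    ((hcompd hh x hx).continuousAt.add
      (Complex.continuous_conj.continuousAt.comp (hcompd hg x hx).continuousAt)).continuousWithinAt
  refine ⟨?_, ?_, ?_⟩
  · intro a ha b hb hab
    by_contra hne
    have h1 := hmono _ ⟨a, ha, rfl⟩ _ ⟨b, hb, rfl⟩ fun h => hne (hinj ha hb h)
    simp only [harmonicMap, Function.comp_apply, hχ a ha, hχ b hb] at h1 hab
    rw [hab, sub_self, inner_zero_left] at h1
    exact lt_irrefl _ h1
  · rw [← himage]
    exact isOpen_image_harmonicMap hΩo (hcompd hh) (hcompd hg) fun x hx => hcomp _ (hχmem x hx)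
  · rw [← himage]
    exact hasNoncrossingRays_compl_image hΩc hΩo ⟨φ 0, 0, Metric.mem_ball_self hρ, rfl⟩ hΩb hcont
      hmono

end ConvexComparison

/-! ### Local injectivity and nonvanishing derivative. -/

section LocallyInjective

/-- Zeros of $h'$ are isolated, so the continuous local inverse is differentiable off $h(z)$, and at
$h(z)$ by removability. The chain rule then excludes $h'(z)=0$. -/
theorem deriv_ne_zero_of_injOn_nhds {h : ℂ → ℂ} {z : ℂ} (hh : AnalyticAt ℂ h z) {V : Set ℂ}
    (hV : V ∈ nhds z) (hinj : Set.InjOn h V) : deriv h z ≠ 0 := by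
  have hnonconst : ∀ w, V ∈ nhds w → ¬ ∀ᶠ y in nhds w, h y = h w := by
    intro w hw hev
    have h1 : ∀ᶠ y in nhds w, y = w := by
      filter_upwards [hev, hw] with y hy hyV using hinj hyV (mem_of_mem_nhds hw) hy
    obtain ⟨y, hy, hne⟩ := ((h1.filter_mono nhdsWithin_le_nhds).and
      (self_mem_nhdsWithin : {w}ᶜ ∈ nhdsWithin w {w}ᶜ)).exists
    exact hne hy
  have hev : ∀ᶠ y in nhdsWithin z {z}ᶜ, deriv h y ≠ 0 := by
    refine hh.deriv.eventually_eq_zero_or_eventually_ne_zero.resolve_left fun h0 => ?_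
    obtain ⟨r, hr, hball⟩ := Metric.eventually_nhds_iff_ball.1
      (h0.and hh.eventually_analyticAt)
    refine hnonconst z hV ?_
    filter_upwards [Metric.ball_mem_nhds z hr] with y hy
    exact Metric.isOpen_ball.is_const_of_deriv_eq_zero (convex_ball z r).isPreconnected
      (fun w hw => (hball w hw).2.differentiableAt.differentiableWithinAt)
      (fun w hw => (hball w hw).1) hy (Metric.mem_ball_self hr)
  rw [eventually_nhdsWithin_iff] at hev
  obtain ⟨r, hr, hball⟩ := Metric.eventually_nhds_iff_ball.1
    (hev.and (hh.eventually_analyticAt.and hV))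
  set U := Metric.ball z r
  have hU : ∀ w ∈ U, U ∈ nhds w := fun w hw => Metric.isOpen_ball.mem_nhds hw
  have hUV : U ⊆ V := fun w hw => (hball w hw).2.2
  set χ := Function.invFunOn h U
  have hχ : ∀ w ∈ U, χ (h w) = w := (hinj.mono hUV).leftInvOn_invFunOn
  have hopen : ∀ w ∈ U, nhds (h w) ≤ Filter.map h (nhds w) := fun w hw =>
    ((hball w hw).2.1.eventually_constant_or_nhds_le_map_nhds).resolve_left
      (hnonconst w (Filter.mem_of_superset (hU w hw) hUV))
  have hcont : ∀ w ∈ U, ContinuousAt χ (h w) := by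
    intro w hw
    rw [ContinuousAt, hχ w hw]
    refine (Filter.map_mono (hopen w hw)).trans ?_
    rw [Filter.map_map]
    refine Filter.tendsto_id.congr' ?_
    filter_upwards [hU w hw] with y hy using (hχ y hy).symm
  have hzU : z ∈ U := Metric.mem_ball_self hr
  have himg : ∀ w ∈ U, h '' U ∈ nhds (h w) := fun w hw =>
    hopen w hw (Filter.image_mem_map (hU w hw))
  have hdiff : DifferentiableOn ℂ χ (h '' U) := by
    rw [← Complex.differentiableOn_compl_singleton_and_continuousAt_iff (himg z hzU)]
    refine ⟨?_, hcont z hzU⟩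
    rintro _ ⟨⟨w, hw, rfl⟩, hne⟩
    have hwz : w ≠ z := fun h => hne (by rw [h]; rfl)
    refine (HasDerivAt.of_local_left_inverse (f := h) (f' := deriv h w) (hcont w hw) ?_
      ((hball w hw).1 hwz) ?_).differentiableAt.differentiableWithinAt
    · rw [hχ w hw]
      exact (hball w hw).2.1.differentiableAt.hasDerivAt
    · filter_upwards [himg w hw]
      rintro _ ⟨y, hy, rfl⟩
      rw [hχ y hy]
  have h1 : HasDerivAt (χ ∘ h) (deriv χ (h z) * deriv h z) z :=
    (hdiff.differentiableAt (himg z hzU)).hasDerivAt.comp z hh.differentiableAt.hasDerivAt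
  have h2 : HasDerivAt (χ ∘ h) 1 z := by
    refine (hasDerivAt_id z).congr_of_eventuallyEq ?_
    filter_upwards [hU z hzU] with y hy using hχ y hy
  intro h0
  rw [h0, mul_zero] at h1
  exact zero_ne_one (h1.unique h2)

end LocallyInjective

/-! ### Herglotz integrals and the splitting into positive parts. -/

section Herglotz

/-- The Herglotz integral of a real function on the circle of radius `r`. -/
noncomputable def herglotzIntegral (k : ℂ → ℝ) (r : ℝ) (w : ℂ) : ℂ :=
  Real.circleAverage (fun ζ => herglotzRieszKernel 0 w ζ • (k ζ : ℂ)) 0 r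

variable {k : ℂ → ℝ} {r : ℝ}

theorem ContinuousOn.circleIntegrable_ofReal (hr : 0 ≤ r)
    (hk : ContinuousOn k (Metric.sphere 0 r)) :
    CircleIntegrable (fun ζ => (k ζ : ℂ)) 0 r :=
  (Complex.continuous_ofReal.comp_continuousOn hk).circleIntegrable hr

theorem differentiableOn_herglotzIntegral (hr : 0 ≤ r) (hk : ContinuousOn k (Metric.sphere 0 r)) :
    DifferentiableOn ℂ (herglotzIntegral k r) (Metric.ball 0 r) :=
  differentiableOn_circleAverage_herglotzRieszKernel_smul (hk.circleIntegrable_ofReal hr)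

theorem herglotzIntegral_zero (hr : 0 < r) (hk : ContinuousOn k (Metric.sphere 0 r)) :
    herglotzIntegral k r 0 = ((Real.circleAverage k 0 r : ℝ) : ℂ) := by
  rw [herglotzIntegral, ← Complex.ofRealCLM_apply,
    ← Complex.ofRealCLM.circleAverage_comp_comm (hk.circleIntegrable hr.le)]
  refine Real.circleAverage_congr_sphere fun ζ hζ => ?_
  rw [abs_of_pos hr] at hζ
  have : ζ ≠ 0 := ne_zero_of_mem_sphere hr.ne' ⟨ζ, hζ⟩
  simp [herglotzRieszKernel_def, div_self this]

theorem continuousOn_re_herglotzRieszKernel {w : ℂ} (hw : w ∈ Metric.ball (0 : ℂ) r) :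
    ContinuousOn (Complex.re ∘ herglotzRieszKernel 0 w) (Metric.sphere 0 r) := by
  have := continuousOn_herglotzRieszKernel_sphere hw
  rw [abs_of_pos (Metric.pos_of_mem_ball hw)] at this
  exact Complex.continuous_re.comp_continuousOn this

/-- Harnack's lower bound for the Poisson kernel; a positive mean makes the real part strictly
positive. -/
theorem le_re_herglotzIntegral (hk : ContinuousOn k (Metric.sphere 0 r))
    (hk0 : ∀ ζ, 0 ≤ k ζ) {w : ℂ} (hw : w ∈ Metric.ball (0 : ℂ) r) :
    (r - ‖w‖) / (r + ‖w‖) * Real.circleAverage k 0 r ≤ (herglotzIntegral k r w).re := by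
  have hr := Metric.pos_of_mem_ball hw
  rw [herglotzIntegral, re_circleAverage_herglotzRieszKernel_smul (hk.circleIntegrable hr.le) hw,
    ← smul_eq_mul, ← Real.circleAverage_smul]
  refine Real.circleAverage_mono ((hk.const_smul _).circleIntegrable hr.le)
    (((continuousOn_re_herglotzRieszKernel hw).mul hk).circleIntegrable hr.le) fun ζ hζ => ?_
  rw [abs_of_pos hr] at hζ
  have := le_re_herglotzRieszKernel hζ hw
  simp only [Pi.smul_apply, smul_eq_mul, Function.comp_apply, Pi.smul_apply']
  refine mul_le_mul_of_nonneg_right ?_ (hk0 ζ)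
  simpa [herglotzRieszKernel_def] using this

theorem re_herglotzIntegral_re_eq {P : ℂ → ℂ} (hP : AnalyticOnNhd ℂ P (Metric.closedBall 0 r))
    {w : ℂ} (hw : w ∈ Metric.ball (0 : ℂ) r) :
    (herglotzIntegral (fun ζ => (P ζ).re) r w).re = (P w).re := by
  have hr := Metric.pos_of_mem_ball hw
  have hc : ContinuousOn (fun ζ => (P ζ).re) (Metric.sphere 0 r) :=
    Complex.continuous_re.comp_continuousOn (hP.continuousOn.mono Metric.sphere_subset_closedBall)
  rw [herglotzIntegral, re_circleAverage_herglotzRieszKernel_smul (hc.circleIntegrable hr.le) hw]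
  exact InnerProductSpace.HarmonicOnNhd.circleAverage_re_herglotzRieszKernel_smul
    (f := fun ζ => (P ζ).re) (fun z hz => (hP z hz).harmonicAt_re) hw

theorem herglotzIntegral_sub {k₁ k₂ : ℂ → ℝ} (hk₁ : ContinuousOn k₁ (Metric.sphere 0 r))
    (hk₂ : ContinuousOn k₂ (Metric.sphere 0 r)) {w : ℂ} (hw : w ∈ Metric.ball (0 : ℂ) r) :
    herglotzIntegral (fun ζ => k₁ ζ - k₂ ζ) r w =
      herglotzIntegral k₁ r w - herglotzIntegral k₂ r w := by
  have hr := Metric.pos_of_mem_ball hw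
  have hK := continuousOn_herglotzRieszKernel_sphere hw
  refine Eq.trans ?_ (Real.circleAverage_sub
    ((hk₁.circleIntegrable_ofReal hr.le).continuousOn_smul hK)
    ((hk₂.circleIntegrable_ofReal hr.le).continuousOn_smul hK))
  refine congrArg (Real.circleAverage · 0 r) (funext fun ζ => ?_)
  simp only [Complex.ofReal_sub, smul_sub, Pi.sub_apply]

/-- An analytic function with value `1` at the center is a difference of functions with positive
real part, with total mass given by the mean of `|Re P|`. -/
theorem exists_re_nonneg_sub_eq {P : ℂ → ℂ} (hr : 0 < r)
    (hP : AnalyticOnNhd ℂ P (Metric.closedBall 0 r)) (hP0 : P 0 = 1) :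
    ∃ (b : ℝ) (S₁ S₂ : ℂ → ℂ), 0 ≤ b ∧ 1 + 2 * b = Real.circleAverage (fun z => |(P z).re|) 0 r ∧
      DifferentiableOn ℂ S₁ (Metric.ball 0 r) ∧ DifferentiableOn ℂ S₂ (Metric.ball 0 r) ∧
      S₁ 0 = 1 + b ∧ S₂ 0 = b ∧ (∀ z ∈ Metric.ball (0 : ℂ) r, 0 < (S₁ z).re) ∧
      (∀ z ∈ Metric.ball (0 : ℂ) r, 0 ≤ (S₂ z).re) ∧
      ∀ z ∈ Metric.ball (0 : ℂ) r, P z = S₁ z - S₂ z := by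
  have hc : ContinuousOn (fun ζ => (P ζ).re) (Metric.sphere 0 r) :=
    Complex.continuous_re.comp_continuousOn (hP.continuousOn.mono Metric.sphere_subset_closedBall)
  -- The two summands are the Herglotz integrals of the positive and negative parts of
  -- $\mathrm{Re}\,P$. Their means are $1+b$ and $b$, since $\mathrm{Re}\,P$ has mean
  -- $\mathrm{Re}\,P(0)=1$.
  set k₁ : ℂ → ℝ := fun ζ => max (P ζ).re 0 with hk₁
  set k₂ : ℂ → ℝ := fun ζ => max (-(P ζ).re) 0 with hk₂
  have hc₁ : ContinuousOn k₁ (Metric.sphere 0 r) := hc.sup continuousOn_const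
  have hc₂ : ContinuousOn k₂ (Metric.sphere 0 r) := hc.neg.sup continuousOn_const
  have hsub : (fun ζ => k₁ ζ - k₂ ζ) = fun ζ => (P ζ).re := by
    funext ζ
    simp only [hk₁, hk₂]
    rcases le_total (P ζ).re 0 with h | h
    · rw [max_eq_right h, max_eq_left (neg_nonneg.2 h)]; ring
    · rw [max_eq_left h, max_eq_right (neg_nonpos.2 h)]; ring
  have hadd : (fun ζ => k₁ ζ + k₂ ζ) = fun ζ => |(P ζ).re| := by
    funext ζ
    simp only [hk₁, hk₂]
    rcases le_total (P ζ).re 0 with h | h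
    · rw [max_eq_right h, max_eq_left (neg_nonneg.2 h), abs_of_nonpos h]; ring
    · rw [max_eq_left h, max_eq_right (neg_nonpos.2 h), abs_of_nonneg h]; ring
  have h0 : (0 : ℂ) ∈ Metric.ball (0 : ℂ) r := Metric.mem_ball_self hr
  have hdiff : ∀ z ∈ Metric.ball (0 : ℂ) r, herglotzIntegral (fun ζ => (P ζ).re) r z =
      herglotzIntegral k₁ r z - herglotzIntegral k₂ r z := by
    intro z hz
    rw [← hsub]
    exact herglotzIntegral_sub hc₁ hc₂ hz
  have hmean : Real.circleAverage k₁ 0 r - Real.circleAverage k₂ 0 r = 1 := by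
    have h1 := re_herglotzIntegral_re_eq hP h0
    rwa [hdiff 0 h0, herglotzIntegral_zero hr hc₁, herglotzIntegral_zero hr hc₂, hP0,
      ← Complex.ofReal_sub, Complex.ofReal_re, Complex.one_re] at h1
  have hnonneg : ∀ {k : ℂ → ℝ}, ContinuousOn k (Metric.sphere 0 r) → (∀ ζ, 0 ≤ k ζ) →
      0 ≤ Real.circleAverage k 0 r := fun _ h => Real.circleAverage_nonneg_of_nonneg fun ζ _ => h ζ
  have hb := hnonneg hc₂ fun ζ => le_max_right _ _
  have ha : 0 < Real.circleAverage k₁ 0 r := by linarith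
  have hfac : ∀ z ∈ Metric.ball (0 : ℂ) r, 0 < (r - ‖z‖) / (r + ‖z‖) := fun z hz =>
    div_pos (sub_pos.2 (mem_ball_zero_iff.1 hz)) (by positivity)
  refine ⟨Real.circleAverage k₂ 0 r, herglotzIntegral k₁ r, herglotzIntegral k₂ r, hb, ?_,
    differentiableOn_herglotzIntegral hr.le hc₁, differentiableOn_herglotzIntegral hr.le hc₂,
    ?_, herglotzIntegral_zero hr hc₂, ?_, ?_, ?_⟩
  · rw [← hadd, Real.circleAverage_fun_add (hc₁.circleIntegrable hr.le)
      (hc₂.circleIntegrable hr.le)]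
    linarith
  · rw [herglotzIntegral_zero hr hc₁, ← Complex.ofReal_one, ← Complex.ofReal_add]
    congr 1
    linarith
  · intro z hz
    exact lt_of_lt_of_le (mul_pos (hfac z hz) ha)
      (le_re_herglotzIntegral hc₁ (fun ζ => le_max_right _ _) hz)
  · intro z hz
    exact (mul_nonneg (hfac z hz).le hb).trans
      (le_re_herglotzIntegral hc₂ (fun ζ => le_max_right _ _) hz)
  · have hPd : DifferentiableOn ℂ P (Metric.ball 0 r) :=
      hP.differentiableOn.mono Metric.ball_subset_closedBall
    have hcre : ContinuousOn (fun ζ => (P ζ).re) (Metric.sphere 0 r) := hc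
    obtain ⟨c, hc⟩ := AnalyticOnNhd.eq_const_of_re_eq_const (c₀ := 0)
      (f := fun z => P z - herglotzIntegral (fun ζ => (P ζ).re) r z)
      ((hPd.sub (differentiableOn_herglotzIntegral hr.le hcre)).analyticOnNhd Metric.isOpen_ball)
      (fun z hz => by rw [Complex.sub_re, re_herglotzIntegral_re_eq hP hz, sub_self])
      Metric.isOpen_ball ⟨⟨0, h0⟩, (convex_ball (0 : ℂ) r).isPreconnected⟩
    have hc0 : c = 0 := by
      rw [← hc 0 h0, hP0, hdiff 0 h0, herglotzIntegral_zero hr hc₁, herglotzIntegral_zero hr hc₂,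
        ← Complex.ofReal_sub, hmean, Complex.ofReal_one, sub_self]
    intro z hz
    rw [← hdiff z hz]
    exact sub_eq_zero.1 ((hc z hz).trans hc0)

end Herglotz

/-! ### Representation of $h'$ for bounded boundary rotation. -/

section BoundaryRotation

/-- $(S-a)/z$ has a removable singularity at $0$, filled by `dslope`, and hence a primitive on the
disk. -/
theorem exists_primitive_of_sub_eq_mul {S : ℂ → ℂ} {r a : ℝ}
    (hS : DifferentiableOn ℂ S (Metric.ball 0 r)) (hr : 0 < r) (hS0 : S 0 = a) :
    ∃ T T' : ℂ → ℂ, T 0 = 0 ∧ (∀ z ∈ Metric.ball (0 : ℂ) r, HasDerivAt T (T' z) z) ∧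
      (∀ z, a + z * T' z = S z) ∧ T' 0 = deriv S 0 := by
  have hd : DifferentiableOn ℂ (dslope S 0) (Metric.ball 0 r) :=
    (Complex.differentiableOn_dslope (Metric.ball_mem_nhds 0 hr)).2 hS
  obtain ⟨T, hT0, hT⟩ := hd.isExactOn_ball.with_val_at 0 0
  refine ⟨T, dslope S 0, hT0, hT, fun z => ?_, dslope_same _ _⟩
  have := sub_smul_dslope S 0 z
  rw [sub_zero, smul_eq_mul, hS0] at this
  rw [this]; ring

/-- Representation of the derivative of a function of bounded boundary rotation on a smaller
disk. -/
theorem MemVK.exists_deriv_eq_exp_sub {K : ℝ} {h : ℂ → ℂ} (hh : MemVK K h) {r : ℝ} (hr : 0 < r)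
    (hr1 : r < 1) :
    ∃ (b : ℝ) (T₁ T₁' T₂ T₂' : ℂ → ℂ), 0 ≤ b ∧ 4 * b ≤ K - 2 ∧
      (∀ z ∈ Metric.ball (0 : ℂ) r, HasDerivAt T₁ (T₁' z) z) ∧
      (∀ z ∈ Metric.ball (0 : ℂ) r, HasDerivAt T₂ (T₂' z) z) ∧
      (∀ z ∈ Metric.ball (0 : ℂ) r, deriv h z = Complex.exp (T₁ z - T₂ z)) ∧
      (∀ z ∈ Metric.ball (0 : ℂ) r, 0 < (1 + b + z * T₁' z).re) ∧
      ∀ z ∈ Metric.ball (0 : ℂ) r, 0 ≤ (b + z * T₂' z).re := by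
  have hne : ∀ z ∈ Metric.ball (0 : ℂ) 1, deriv h z ≠ 0 := fun z hz => by
    obtain ⟨V, hV, hinj⟩ := hh.locallyUnivalent z hz
    exact deriv_ne_zero_of_injOn_nhds (hh.analytic z hz) hV hinj
  have hsub : Metric.closedBall (0 : ℂ) r ⊆ Metric.ball 0 1 := Metric.closedBall_subset_ball hr1
  have hsub' : Metric.ball (0 : ℂ) r ⊆ Metric.ball 0 1 := Metric.ball_subset_ball hr1.le
  set u : ℂ → ℂ := fun z => deriv (deriv h) z / deriv h z with hu
  have hua : ∀ z ∈ Metric.ball (0 : ℂ) 1, AnalyticAt ℂ u z := fun z hz =>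
    (hh.analytic z hz).deriv.deriv.div (hh.analytic z hz).deriv (hne z hz)
  set P : ℂ → ℂ := fun z => 1 + z * u z with hPdef
  have hPa : ∀ z ∈ Metric.ball (0 : ℂ) 1, AnalyticAt ℂ P z := fun z hz =>
    analyticAt_const.add (analyticAt_id.mul (hua z hz))
  obtain ⟨b, S₁, S₂, hb, hbK, hS₁, hS₂, hS₁0, hS₂0, hS₁p, hS₂p, hPS⟩ :=
    exists_re_nonneg_sub_eq hr (fun z hz => hPa z (hsub hz)) (by simp [hPdef])
  obtain ⟨T₁, T₁', hT₁0, hT₁, hT₁S, hT₁'0⟩ :=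
    exists_primitive_of_sub_eq_mul (a := 1 + b) hS₁ hr (by push_cast; exact hS₁0)
  obtain ⟨T₂, T₂', hT₂0, hT₂, hT₂S, hT₂'0⟩ := exists_primitive_of_sub_eq_mul hS₂ hr hS₂0
  have h0 : (0 : ℂ) ∈ Metric.ball (0 : ℂ) r := Metric.mem_ball_self hr
  have hTu : ∀ z ∈ Metric.ball (0 : ℂ) r, T₁' z - T₂' z = u z := by
    intro z hz
    rcases eq_or_ne z 0 with rfl | hz0
    · have hnhds := Metric.isOpen_ball.mem_nhds h0
      have h1 : HasDerivAt (fun z => S₁ z - S₂ z) (T₁' 0 - T₂' 0) 0 := by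
        rw [hT₁'0, hT₂'0]
        exact (hS₁.differentiableAt hnhds).hasDerivAt.sub (hS₂.differentiableAt hnhds).hasDerivAt
      have h2 : HasDerivAt P (u 0) 0 := by
        have := ((hasDerivAt_id (0 : ℂ)).mul
          (hua 0 (hsub' h0)).differentiableAt.hasDerivAt).const_add 1
        simpa [hPdef] using this
      refine h1.unique (h2.congr_of_eventuallyEq ?_)
      filter_upwards [hnhds] with y hy using (hPS y hy).symm
    · have h1 := hT₁S z
      have h2 := hT₂S z
      have h3 := hPS z hz
      push_cast at h1
      refine mul_left_cancel₀ hz0 ?_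
      simp only [hPdef] at h3
      linear_combination h1 - h2 - h3
  refine ⟨b, T₁, T₁', T₂, T₂', hb, ?_, hT₁, hT₂, ?_, ?_, ?_⟩
  · have h1 := hh.rotation_le r hr hr1
    have h2 : 1 + 2 * b ≤ (2 * Real.pi)⁻¹ * (K * Real.pi) := by
      rw [hbK, Real.circleAverage, smul_eq_mul]
      refine mul_le_mul_of_nonneg_left (le_of_eq_of_le ?_ h1) (by positivity)
      refine intervalIntegral.integral_congr fun t _ => ?_
      simp only [hPdef, hu, circleMap_zero, mul_div_assoc]
    have h3 : (2 * Real.pi)⁻¹ * (K * Real.pi) = K / 2 := by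
      field_simp
    rw [h3] at h2
    linarith
  -- $h'$ and $e^{T_1-T_2}$ have the same logarithmic derivative and both equal $1$ at $0$.
  · have hder : ∀ z ∈ Metric.ball (0 : ℂ) r,
        HasDerivAt (fun z => deriv h z * Complex.exp (T₂ z - T₁ z)) 0 z := by
      intro z hz
      have h1 := (hh.analytic z (hsub' hz)).deriv.differentiableAt.hasDerivAt.mul
        ((hT₂ z hz).sub (hT₁ z hz)).cexp
      refine h1.congr_deriv ?_
      have h2 : deriv (deriv h) z = deriv h z * (T₁' z - T₂' z) := by
        rw [hTu z hz, hu]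
        exact (mul_div_cancel₀ _ (hne z (hsub' hz))).symm
      simp only [h2, Pi.sub_apply]
      ring
    intro z hz
    have h1 := Metric.isOpen_ball.is_const_of_deriv_eq_zero (convex_ball (0 : ℂ) r).isPreconnected
      (fun w hw => (hder w hw).differentiableAt.differentiableWithinAt)
      (fun w hw => (hder w hw).deriv) hz h0
    simp only [hT₁0, hT₂0, sub_zero, Complex.exp_zero, mul_one, hh.deriv_zero] at h1
    rw [show T₁ z - T₂ z = -(T₂ z - T₁ z) by ring, Complex.exp_neg]
    exact eq_inv_of_mul_eq_one_left h1
  · intro z hz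
    have := hT₁S z
    push_cast at this
    rw [this]
    exact hS₁p z hz
  · intro z hz
    rw [hT₂S z]
    exact hS₂p z hz

end BoundaryRotation

/-! ### Oscillation of the argument of $h'/\varphi'$. -/

section ArgumentBound

variable {r b : ℝ} {T₁ T₁' T₂ T₂' : ℂ → ℂ}

/-- Oscillation on circles of the argument of `exp (b / (1 + b) * T₁ - T₂)`. -/
theorem im_sub_im_le_of_mem_sphere (hb : 0 ≤ b)
    (hT₁ : ∀ z ∈ Metric.ball (0 : ℂ) r, HasDerivAt T₁ (T₁' z) z)
    (hT₂ : ∀ z ∈ Metric.ball (0 : ℂ) r, HasDerivAt T₂ (T₂' z) z)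
    (hp₁ : ∀ z ∈ Metric.ball (0 : ℂ) r, 0 < (1 + b + z * T₁' z).re)
    (hp₂ : ∀ z ∈ Metric.ball (0 : ℂ) r, 0 ≤ (b + z * T₂' z).re) {ρ : ℝ} (hρ : 0 ≤ ρ) (hr : ρ < r)
    {z w : ℂ} (hz : z ∈ Metric.sphere (0 : ℂ) ρ) (hw : w ∈ Metric.sphere (0 : ℂ) ρ) :
    ∃ q ∈ Set.Ico (0 : ℝ) 1, (((b / (1 + b) : ℝ) : ℂ) * T₁ z - T₂ z).im -
      (((b / (1 + b) : ℝ) : ℂ) * T₁ w - T₂ w).im ≤ 2 * Real.pi * b * q := by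
  obtain ⟨s, -, rfl⟩ := exists_mem_Ico_circleMap_eq hρ hw 0
  obtain ⟨t, ht, rfl⟩ := exists_mem_Ico_circleMap_eq hρ hz s
  have hm₁ := strictMono_add_im_comp_circleMap (a := 1 + b) hT₁
    (fun z hz => by push_cast; exact hp₁ z hz) hρ hr
  have hm₂ : Monotone fun t : ℝ => b * t + (T₂ (circleMap 0 ρ t)).im := by
    refine monotone_of_hasDerivAt_nonneg
      (f' := fun t => (b + circleMap 0 ρ t * T₂' (circleMap 0 ρ t)).re) (fun t => ?_)
      fun t => hp₂ _ (circleMap_mem_ball_of_lt hρ hr t)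
    have h := ((hasDerivAt_id t).const_mul b).add
      (hT₂ _ (circleMap_mem_ball_of_lt hρ hr t)).im_comp_circleMap
    refine h.congr_deriv ?_
    simp
  have h1 := hm₁ ht.2
  have h2 := hm₁.monotone ht.1
  have h3 := hm₂ ht.1
  simp only [periodic_circleMap 0 ρ s] at h1 h2 h3
  -- `Δ` is the increment of a strictly increasing function over less than a full turn, whence
  -- $0\le\Delta<2\pi(1+b)$. The increment of $\mathrm{Im}\,N$ is $\frac b{1+b}\Delta$ minus that of
  -- the nondecreasing $bt+\mathrm{Im}\,T_2$.
  set Δ : ℝ := (1 + b) * (t - s) + (T₁ (circleMap 0 ρ t)).im - (T₁ (circleMap 0 ρ s)).im with hΔ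
  have hb1 : 0 < 1 + b := by linarith
  have hπ : 0 < 2 * Real.pi * (1 + b) := by have := Real.pi_pos; positivity
  refine ⟨Δ / (2 * Real.pi * (1 + b)), ⟨div_nonneg (by rw [hΔ]; linarith) hπ.le,
    (div_lt_one hπ).2 (by rw [hΔ]; linarith)⟩, ?_⟩
  have e1 : 2 * Real.pi * b * (Δ / (2 * Real.pi * (1 + b))) = b / (1 + b) * Δ := by
    have := Real.pi_ne_zero
    field_simp
  have e2 : b / (1 + b) * Δ = b * (t - s) +
      b / (1 + b) * ((T₁ (circleMap 0 ρ t)).im - (T₁ (circleMap 0 ρ s)).im) := by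
    rw [hΔ]; field_simp; ring
  rw [e1, e2, Complex.sub_im, Complex.sub_im, Complex.im_ofReal_mul, Complex.im_ofReal_mul]
  linarith

/-- `v` is the midpoint of the range of $\mathrm{Im}\,N$ on the circle; the maximum principle for
$\mp iN$ carries the bounds inside. -/
theorem exists_abs_im_sub_le {N : ℂ → ℂ} (hN : DifferentiableOn ℂ N (Metric.ball 0 r)) {ρ : ℝ}
    (hρ : 0 < ρ) (hr : ρ < r) :
    ∃ v : ℝ, ∃ z ∈ Metric.sphere (0 : ℂ) ρ, ∃ w ∈ Metric.sphere (0 : ℂ) ρ,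
      ∀ y ∈ Metric.closedBall (0 : ℂ) ρ, |(N y).im - v| ≤ ((N z).im - (N w).im) / 2 := by
  have hc : ContinuousOn (fun z => (N z).im) (Metric.sphere 0 ρ) :=
    Complex.continuous_im.comp_continuousOn (hN.continuousOn.mono
      (Metric.sphere_subset_closedBall.trans (Metric.closedBall_subset_ball hr)))
  have hne : (Metric.sphere (0 : ℂ) ρ).Nonempty := NormedSpace.sphere_nonempty.2 hρ.le
  obtain ⟨z, hz, hmax⟩ := (isCompact_sphere (0 : ℂ) ρ).exists_isMaxOn hne hc
  obtain ⟨w, hw, hmin⟩ := (isCompact_sphere (0 : ℂ) ρ).exists_isMinOn hne hc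
  refine ⟨((N z).im + (N w).im) / 2, z, hz, w, hw, fun y hy => ?_⟩
  have h1 := re_le_of_forall_mem_sphere_re_le (F := fun y => -Complex.I * N y) (M := (N z).im)
    (hN.const_mul _) hρ hr (fun x hx => by simpa using hmax hx) hy
  have h2 := re_le_of_forall_mem_sphere_re_le (F := fun y => Complex.I * N y) (M := -(N w).im)
    (hN.const_mul _) hρ hr (fun x hx => by simpa using hmin hx) hy
  simp only [Complex.mul_re, Complex.neg_re, Complex.neg_im, Complex.I_re, Complex.I_im] at h1 h2
  rw [abs_le]
  constructor <;> linarith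

end ArgumentBound

/-! ### The theorem on smaller disks and the passage to the unit disk. -/

theorem MemVK.harmonicMap_ball {h g : ℂ → ℂ} {K δ θ : ℝ} (hδ : δ ∈ Set.Icc (0 : ℝ) 2)
    (hK : K ≤ 4 - δ) (hh : MemVK K h) (hg : AnalyticOnNhd ℂ g (Metric.ball 0 1))
    (hgh : ∀ z ∈ Metric.ball (0 : ℂ) 1,
      deriv g z = Complex.exp (θ * Complex.I) * (Real.sin (δ * Real.pi / 4) : ℂ) * z * deriv h z)
    {ρ : ℝ} (hρ : 0 < ρ) (hρ1 : ρ < 1) :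
    Set.InjOn (harmonicMap h g) (Metric.ball 0 ρ) ∧ IsOpen (harmonicMap h g '' Metric.ball 0 ρ) ∧
      HasNoncrossingRays (harmonicMap h g '' Metric.ball 0 ρ)ᶜ := by
  obtain ⟨r, hρr, hr1⟩ := exists_between hρ1
  obtain ⟨b, T₁, T₁', T₂, T₂', hb, hbK, hT₁, hT₂, hexp, hp₁, hp₂⟩ :=
    hh.exists_deriv_eq_exp_sub (hρ.trans hρr) hr1
  have hb1 : (0 : ℝ) < 1 + b := by linarith
  have hb1' : (1 + b : ℂ) ≠ 0 := by exact_mod_cast hb1.ne'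
  set N : ℂ → ℂ := fun z => ((b / (1 + b) : ℝ) : ℂ) * T₁ z - T₂ z with hN
  have hNd : DifferentiableOn ℂ N (Metric.ball 0 r) := fun z hz =>
    (((hT₁ z hz).const_mul _).sub (hT₂ z hz)).differentiableAt.differentiableWithinAt
  obtain ⟨v, z₁, hz₁, w₁, hw₁, hv⟩ := exists_abs_im_sub_le hNd hρ hρr
  obtain ⟨q, hq, hosc⟩ := im_sub_im_le_of_mem_sphere hb hT₁ hT₂ hp₁ hp₂ hρ.le hρr hz₁ hw₁
  have hπ := Real.pi_pos
  -- This is $|g'/\varphi'|<\mathrm{Re}(h'/\varphi')$ after division by $e^{\mathrm{Re}\,N}$.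
  have hcos : ∀ z ∈ Metric.ball (0 : ℂ) ρ,
      Real.sin (δ * Real.pi / 4) * ‖z‖ < Real.cos ((N z).im - v) := by
    intro z hz
    have hz1 : ‖z‖ < 1 := (mem_ball_zero_iff.1 hz).trans hρ1
    have h1 := (hv z (Metric.ball_subset_closedBall hz)).trans
      (div_le_div_of_nonneg_right hosc zero_le_two)
    have h2 : |(N z).im - v| ≤ Real.pi * b * q := h1.trans_eq (by ring)
    have h3 : Real.pi * b ≤ Real.pi / 2 - δ * Real.pi / 4 := by nlinarith
    have h4 : Real.pi * b * q ≤ Real.pi * b := mul_le_of_le_one_right (by positivity) hq.2.le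
    -- Strictness matters when $\delta=0$: the sine vanishes and the cosine must still be positive.
    -- It comes from $q<1$ if $b>0$, and is trivial if $b=0$.
    have h5 : |(N z).im - v| < Real.pi / 2 := by
      rcases hb.eq_or_lt with hb0 | hb0
      · rw [← hb0] at h2
        simp only [mul_zero, zero_mul] at h2
        linarith
      · have : Real.pi * b * q < Real.pi * b := mul_lt_of_lt_one_right (by positivity) hq.2
        nlinarith [hδ.1]
    have hs0 : 0 ≤ Real.sin (δ * Real.pi / 4) :=
      Real.sin_nonneg_of_nonneg_of_le_pi (by have := hδ.1; positivity) (by nlinarith [hδ.2])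
    have hc0 : 0 < Real.cos ((N z).im - v) :=
      Real.cos_pos_of_mem_Ioo ⟨(abs_lt.1 h5).1, (abs_lt.1 h5).2⟩
    have hsc : Real.sin (δ * Real.pi / 4) ≤ Real.cos ((N z).im - v) := by
      rw [← Real.cos_pi_div_two_sub, ← Real.cos_abs ((N z).im - v)]
      exact Real.cos_le_cos_of_nonneg_of_le_pi (abs_nonneg _) (by nlinarith [hδ.1])
        (h2.trans (h4.trans h3))
    rcases hs0.eq_or_lt with hs | hs
    · rw [← hs, zero_mul]; exact hc0
    · exact (mul_lt_of_lt_one_right hs hz1).trans_le hsc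
  -- Division by $1+b$ normalizes $\mathrm{Re}(1+b+zT_1')>0$ to the convexity condition; the
  -- rotation by $v$ centers the argument of $h'/\varphi'$.
  set L : ℂ → ℂ := fun z => T₁ z / (1 + b) + v * Complex.I with hL
  have hLd : ∀ z ∈ Metric.ball (0 : ℂ) r, HasDerivAt L (T₁' z / (1 + b)) z := fun z hz =>
    ((hT₁ z hz).div_const _).add_const _
  obtain ⟨φ, hφ⟩ := DifferentiableOn.isExactOn_ball (f := fun z => Complex.exp (L z))
    (c := 0) (r := r) fun z hz => (hLd z hz).cexp.differentiableAt.differentiableWithinAt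
  have hball : Metric.ball (0 : ℂ) ρ ⊆ Metric.ball 0 1 := Metric.ball_subset_ball hρ1.le
  have hquot : ∀ z ∈ Metric.ball (0 : ℂ) ρ,
      deriv h z / Complex.exp (L z) = Complex.exp (N z - v * Complex.I) := by
    intro z hz
    rw [hexp z (Metric.ball_subset_ball hρr.le hz), ← Complex.exp_sub]
    congr 1
    simp only [hL, hN]
    push_cast
    field_simp
    ring
  refine harmonicMap_of_convex_comparison (L' := fun z => T₁' z / (1 + b)) hφ hLd ?_ hρ hρr
    (hh.analytic.differentiableOn.mono hball) (hg.differentiableOn.mono hball) ?_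
  · intro z hz
    have h1 : 1 + z * (T₁' z / (1 + b)) =
        (((1 + b)⁻¹ : ℝ) : ℂ) * (1 + b + z * T₁' z) := by
      push_cast
      field_simp
    rw [h1, Complex.re_ofReal_mul]
    exact mul_pos (inv_pos.2 hb1) (hp₁ z hz)
  · intro z hz
    have h1 : deriv g z / Complex.exp (L z) =
        Complex.exp (θ * Complex.I) * (Real.sin (δ * Real.pi / 4) : ℂ) * z *
          Complex.exp (N z - v * Complex.I) := by
      rw [hgh z (hball hz), ← hquot z hz, mul_div_assoc]
    have hs0 : 0 ≤ Real.sin (δ * Real.pi / 4) :=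
      Real.sin_nonneg_of_nonneg_of_le_pi (by have := hδ.1; positivity) (by nlinarith [hδ.2])
    have hre : (Complex.exp (N z - v * Complex.I)).re =
        Real.exp (N z).re * Real.cos ((N z).im - v) := by
      rw [Complex.exp_re]; simp
    have hno : ‖Complex.exp (N z - v * Complex.I)‖ = Real.exp (N z).re := by
      rw [Complex.norm_exp]; simp
    rw [h1, hquot z hz, hre, norm_mul, norm_mul, norm_mul, hno, Complex.norm_exp_ofReal_mul_I,
      one_mul, Complex.norm_real, Real.norm_of_nonneg hs0, mul_comm]
    exact mul_lt_mul_of_pos_left (hcos z hz) (Real.exp_pos _)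

theorem mainTheorem7 (h g : ℂ → ℂ) (K δ θ : ℝ)
    (hδ : δ ∈ Set.Icc (0 : ℝ) 2) (hK2 : 2 ≤ K) (hK : K ≤ 4 - δ)
    (hh : MemVK K h)
    (hg : AnalyticOnNhd ℂ g (Metric.ball 0 1))
    (hgh : ∀ z ∈ Metric.ball (0 : ℂ) 1,
      deriv g z = Complex.exp (θ * Complex.I) * (Real.sin (δ * Real.pi / 4) : ℂ) * z * deriv h z) :
    Set.InjOn (harmonicMap h g) (Metric.ball 0 1) ∧
      IsCloseToConvexSet (harmonicMap h g '' Metric.ball 0 1) := by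
  obtain ⟨ρ, hρm, hρ, hρt⟩ := exists_seq_strictMono_tendsto' (zero_lt_one : (0 : ℝ) < 1)
  have key := fun n => hh.harmonicMap_ball hδ hK hg hgh (hρ n).1 (hρ n).2
  have hmem : ∀ z ∈ Metric.ball (0 : ℂ) 1, ∀ᶠ n in Filter.atTop, z ∈ Metric.ball (0 : ℂ) (ρ n) := by
    intro z hz
    filter_upwards [hρt.eventually (lt_mem_nhds (mem_ball_zero_iff.1 hz))] with n hn
    exact mem_ball_zero_iff.2 hn
  constructor
  · intro a ha b hb hab
    obtain ⟨n, hna, hnb⟩ := ((hmem a ha).and (hmem b hb)).exists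
    exact (key n).1 hna hnb hab
  -- The omitted set is the decreasing intersection of the closed sets omitted on the smaller disks.
  · have himage : harmonicMap h g '' Metric.ball 0 1 =
        (⋂ n, (harmonicMap h g '' Metric.ball 0 (ρ n))ᶜ)ᶜ := by
      rw [Set.compl_iInter]
      simp only [compl_compl]
      rw [← Set.image_iUnion]
      congr 1
      ext z
      refine ⟨fun hz => ?_, fun hz => ?_⟩
      · obtain ⟨n, hn⟩ := (hmem z hz).exists
        exact Set.mem_iUnion.2 ⟨n, hn⟩
      · obtain ⟨n, hn⟩ := Set.mem_iUnion.1 hz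
        exact Metric.ball_subset_ball (hρ n).2.le hn
    rw [himage]
    refine (HasNoncrossingRays.iInter (fun m n hmn => ?_) (fun n => (key n).2.1.isClosed_compl)
      fun n => (key n).2.2).isCloseToConvexSet_compl
      (isClosed_iInter fun n => (key n).2.1.isClosed_compl)
    exact Set.compl_subset_compl.2
      (Set.image_mono (Metric.ball_subset_ball (hρm.monotone hmn)))
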